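/- Let $m,p\ge 1$ be integers and let $\{\xi_{i,j}: i\in[m],\,j\in[p]\}$, where $[n]=\{1,\dots,n\}$, be real random variables on a probability space which are negatively associated, i.e. for all disjoint $A,A'\subseteq[m]\times[p]$ and all coordinatewise nondecreasing Borel functions $f:\mathbb R^{A}\to\mathbb R$, $g:\mathbb R^{A'}\to\mathbb R$ such that $f(\xi_a,a\in A)$ and $g(\xi_a,a\in A')$ have finite second moments, $\mathrm{Cov}\big(f(\xi_a,a\in A),g(\xi_a,a\in A')\big)\le 0$. Assume that $\mathbb E\,\xi_{i,j}=0$ and $|\xi_{i,j}|\le B$ almost surely for all $i,j$, for some constant $B>0$. Let $\mathbf S=(S_1,\dots,S_p)$ with $S_j=\sum_{i=1}^m\xi_{i,j}$, and assume that the covariance matrix $\Sigma=\big(\mathrm{Cov}(S_j,S_l)\big)_{j,l\in[p]}$ is positive definite. Let $\Sigma^{1/2}$ be its positive semidefinite square root, $\Sigma^{-1/2}=(\Sigma^{1/2})^{-1}$, and let $|\Sigma^{-1/2}|_\infty$ denote the largest absolute value of an entry of $\Sigma^{-1/2}$. Let $\mathcal H_{3,\infty,p}$ be the set of all $h:\mathbb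 R^p\to\mathbb R$ such that for every multi-index $\mathbf k=(k_1,\dots,k_p)\in\mathbb N_0^p$ with $k_1+\cdots+k_p\le 3$ the partial derivative $h^{(\mathbf k)}=\frac{\partial^{k_1}}{\partial x_1^{k_1}}\cdots\frac{\partial^{k_p}}{\partial x_p^{k_p}}h$ exists everywhere and satisfies $\sup_{x}|h^{(\mathbf k)}(x)|\le 1$. For random vectors $\mathbf X,\mathbf Y$ in $\mathbb R^p$ put $$d_{\mathcal H_{3,\infty,p}}\big(\mathcal L(\mathbf X),\mathcal L(\mathbf Y)\big)=\sup_{h\in\mathcal H_{3,\infty,p}}|\mathbb E h(\mathbf X)-\mathbb E h(\mathbf Y)|.$$ Then, with $\mathbf Z\sim\mathcal N(\mathbf 0,I_p)$, $$\begin{aligned} d_{\mathcal H_{3,\infty,p}}\big(\mathcal L(\Sigma^{-1/2}(\mathbf S-\mathbb E\mathbf S)),\mathcal L(\mathbf Z)\big)\le{}&\frac56\,p^3B\,|\Sigma^{-1/2}|_\infty^3\sum_{j=1}^p\Sigma_{j,j}\\ &-\Big(\frac32\,p^3B\,|\Sigma^{-1/2}|_\infty^3+p^2|\Sigma^{-1/2}|_\infty^2\Big)\sum_{j=1}^p\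 \sum_{i,k\in[m],\,i\ne k}\mathrm{Cov}(\xi_{i,j},\xi_{k,j})\\ &-\Big(\frac23\,p^3B\,|\Sigma^{-1/2}|_\infty^3+p^2|\Sigma^{-1/2}|_\infty^2\Big)\sum_{j,l\in[p],\,j\ne l}\Sigma_{j,l}, \end{aligned}$$ where the sums over $i\ne k$ and $j\ne l$ run over ordered pairs. -/

import Mathlib

open MeasureTheory ProbabilityTheory
open scoped BigOperators ENNReal MatrixOrder

noncomputable section

namespace NegAssoc

/-- A finite family `ξ` of real random variables is negatively associated under `P`: functions of
disjoint subfamilies, each coordinatewise nondecreasing, Borel and with finite second moment,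
have nonpositive covariance. -/
def NegativelyAssociated {Ω ι : Type*} [MeasurableSpace Ω] (P : Measure Ω) (ξ : ι → Ω → ℝ) :
    Prop :=
  ∀ A B : Finset ι, Disjoint A B →
    ∀ (f : (A → ℝ) → ℝ) (g : (B → ℝ) → ℝ), Monotone f → Monotone g →
      Measurable f → Measurable g →
      MemLp (fun ω => f fun a => ξ a ω) 2 P → MemLp (fun ω => g fun b => ξ b ω) 2 P →
      cov[fun ω => f fun a => ξ a ω, fun ω => g fun b => ξ b ω; P] ≤ 0

/-- `h` restricted to the line through `x` in the `i`-th coordinate direction. -/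
def slice {p : ℕ} (i : Fin p) (h : (Fin p → ℝ) → ℝ) (x : Fin p → ℝ) : ℝ → ℝ :=
  fun t => h (Function.update x i t)

/-- The first order partial derivative `∂h / ∂x_i` (with the value `0` where it does not exist). -/
def partialDeriv {p : ℕ} (i : Fin p) (h : (Fin p → ℝ) → ℝ) : (Fin p → ℝ) → ℝ :=
  fun x => deriv (slice i h x) (x i)

/-- The partial derivative `h^(k) = (∂/∂x_1)^{k_1} ⋯ (∂/∂x_p)^{k_p} h` for a multi-index `k`. -/
def multiDeriv {p : ℕ} (k : Fin p → ℕ) (h : (Fin p → ℝ) → ℝ) : (Fin p → ℝ) → ℝ :=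
  (List.finRange p).foldr (fun i g => (partialDeriv i)^[k i] g) h

/-- All partial derivatives `h^(k)` with `|k|₁ ≤ m` exist everywhere. Every multi-index of positive
order is `k + e_i` with `k_j = 0` for all `j < i`, and then `h^(k + e_i)` is the partial derivative
of `h^(k)` in direction `i`. -/
def PartialsExist {p : ℕ} (m : ℕ) (h : (Fin p → ℝ) → ℝ) : Prop :=
  ∀ (k : Fin p → ℕ) (i : Fin p), (∑ j, k j) + 1 ≤ m → (∀ j, j < i → k j = 0) →
    ∀ x, DifferentiableAt ℝ (slice i (multiDeriv k h) x) (x i)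

/-- `max_{|k|₁ ≤ m} sup_x |h^(k)(x)|`, with values in `[0, ∞]`. -/
def smoothNorm {p : ℕ} (m : ℕ) (h : (Fin p → ℝ) → ℝ) : ℝ≥0∞ :=
  ⨆ (k : Fin p → ℕ) (_ : ∑ j, k j ≤ m) (x : Fin p → ℝ), ENNReal.ofReal |multiDeriv k h x|

/-- The space `L^∞_m(ℝ^p)`. -/
def smoothSpace (m p : ℕ) : Set ((Fin p → ℝ) → ℝ) :=
  {h | PartialsExist m h ∧ smoothNorm m h < ∞}

/-- The unit ball `H_{m,∞,p}` of `L^∞_m(ℝ^p)`. -/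
def smoothBall (m p : ℕ) : Set ((Fin p → ℝ) → ℝ) :=
  {h | h ∈ smoothSpace m p ∧ smoothNorm m h ≤ 1}

/-- The smooth functions metric between two laws on `ℝ^p`. -/
def smoothDist {p : ℕ} (m : ℕ) (μ ν : Measure (Fin p → ℝ)) : ℝ :=
  ⨆ h : smoothBall m p, |∫ x, h.1 x ∂μ - ∫ x, h.1 x ∂ν|

theorem multiDeriv_zero {p : ℕ} (h : (Fin p → ℝ) → ℝ) : multiDeriv 0 h = h := by
  simp [multiDeriv]

theorem abs_le_one_of_mem_smoothBall {m p : ℕ} {h : (Fin p → ℝ) → ℝ} (hh : h ∈ smoothBall m p)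
    (x : Fin p → ℝ) : |h x| ≤ 1 := by
  have h1 : ENNReal.ofReal |multiDeriv 0 h x| ≤ smoothNorm m h := by
    unfold smoothNorm
    exact le_iSup_of_le 0 (le_iSup_of_le (by simp) (le_iSup_of_le x le_rfl))
  have h2 := h1.trans hh.2
  rw [multiDeriv_zero] at h2
  simpa using h2

/-- For probability measures the supremum that defines `smoothDist` is over a bounded set. -/
theorem smoothDist_bddAbove {m p : ℕ} (μ ν : Measure (Fin p → ℝ)) [IsProbabilityMeasure μ]
    [IsProbabilityMeasure ν] :
    BddAbove (Set.range fun h : smoothBall m p => |∫ x, h.1 x ∂μ - ∫ x, h.1 x ∂ν|) := by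
  refine ⟨2, ?_⟩
  rintro _ ⟨h, rfl⟩
  have key : ∀ (ρ : Measure (Fin p → ℝ)) [IsProbabilityMeasure ρ], |∫ x, h.1 x ∂ρ| ≤ 1 := by
    intro ρ _
    have := norm_integral_le_of_norm_le_const (μ := ρ) (f := h.1) (C := 1)
      (Filter.Eventually.of_forall fun x => by
        simpa using abs_le_one_of_mem_smoothBall h.2 x)
    simpa using this
  have := abs_sub (∫ x, h.1 x ∂μ) (∫ x, h.1 x ∂ν)
  have h1 := key μ
  have h2 := key ν
  rw [abs_le] at *
  constructor <;> linarith [h1.1, h1.2, h2.1, h2.2]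

/-- The standard normal law `N(0, I_p)` on `ℝ^p`. -/
def stdNormal (p : ℕ) : Measure (Fin p → ℝ) := Measure.pi fun _ => gaussianReal 0 1

/-- The column sums `S_j = ∑_i ξ_{i,j}`. -/
def colSum {Ω : Type*} {m p : ℕ} (ξ : Fin m × Fin p → Ω → ℝ) (j : Fin p) (ω : Ω) : ℝ :=
  ∑ i, ξ (i, j) ω

/-- The covariance matrix of a random vector. -/
def covMatrix {Ω : Type*} [MeasurableSpace Ω] {p : ℕ} (P : Measure Ω) (S : Fin p → Ω → ℝ) :
    Matrix (Fin p) (Fin p) ℝ :=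
  Matrix.of fun j l => cov[S j, S l; P]

/-- `H^{-1/2} = (H^{1/2})⁻¹`, where `H^{1/2}` is the positive semidefinite square root. -/
def invSqrt {p : ℕ} (H : Matrix (Fin p) (Fin p) ℝ) : Matrix (Fin p) (Fin p) ℝ := (CFC.sqrt H)⁻¹

/-- The largest absolute value of an entry. -/
def entrySup {p : ℕ} (M : Matrix (Fin p) (Fin p) ℝ) : ℝ := ⨆ q : Fin p × Fin p, |M q.1 q.2|

/-- The standardized vector `Σ^{-1/2} (S - E S)`, where `Σ` is the covariance matrix of `S`. -/
def standardized {Ω : Type*} [MeasurableSpace Ω] {p : ℕ} (P : Measure Ω) (S : Fin p → Ω → ℝ)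
    (ω : Ω) : Fin p → ℝ :=
  (invSqrt (covMatrix P S)).mulVec fun j => S j ω - ∫ ω', S j ω' ∂P

end NegAssoc

end

/-!
The proof is Stein's method for the normal law, run through an interpolation rather than through
solutions of the Stein equation.

Let `W` be the standardized vector, `Z` an independent standard normal vector and
`U θ = E h (sin θ • W + cos θ • Z)`. Integration by parts in `Z` turns `sin θ * U' θ` into
`cos θ` times the mean, over `Z`, of the Stein operator `⟨w, ∇F⟩ - ΔF` of
`F w = h (sin θ • w + cos θ • Z)` at `W` (`sin_mul_deriv_interpolation`). The partial derivatives of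
`F` of order `k` carry a factor `sin θ ^ k`, so a bound `A₂ c₂ + A₃ c₃` for the Stein discrepancy,
where `c₂` and `c₃` bound the second and third partial derivatives, gives the distance
`A₂ / 2 + A₃ / 3` (`abs_integral_sub_stdNormal_le`).

For the Stein discrepancy, the linear map `Σ^{-1/2}` is absorbed into the test function
(`steinOp_mulVec`), and each term `E ξ_a g(S)` is compared with the sums `T` that leave `ξ_a` out.
To first order, `ξ_a g(S)` is `ξ_a g(T) + ξ_a² g'(T)`, and the covariances of `ξ_a` with `g(T)` and
of `ξ_a²` with `g'(T)` are controlled by the covariances of `ξ_a` with the other variables, because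
a Lipschitz function becomes monotone after a linear function is added
(`NegativelyAssociated.abs_cov_le`). Summing over `a`
(`NegativelyAssociated.abs_integral_covSteinOp_le`) gives the coefficients `2/3`, `4/3` and `2/3` of
`p³ B |Σ^{-1/2}|_∞³`, which are at most those claimed.

The functions in `smoothBall` only have their mixed partial derivatives in one order of
differentiation, and these need not be continuous. Their iterated increments, which do not depend
on an order, are nevertheless bounded (`hasBoundedIncrements_of_mem_smoothBall`); this property
passes to convolutions with bump functions, which are smooth, satisfy the same bounds and
approximate `h` uniformly (`HasBoundedIncrements.exists_isSmoothUnit`).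
-/

namespace NegAssoc

variable {p : ℕ}

/-! ### Increments and partial derivatives along coordinate directions -/

/-- The increment `h (x + s e_i) - h x`. -/
def increment (i : Fin p) (s : ℝ) (h : (Fin p → ℝ) → ℝ) : (Fin p → ℝ) → ℝ :=
  fun x => h (x + Pi.single i s) - h x

/-- `f'` is the partial derivative of `f` in direction `i`, at every point. -/
def HasPartial (i : Fin p) (f f' : (Fin p → ℝ) → ℝ) : Prop :=
  ∀ x, HasDerivAt (fun s : ℝ => f (x + Pi.single i s)) (f' x) 0

/-- The partial derivative in direction `i`, read off from the Fréchet derivative; unlike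
`partialDeriv` it is only meant for differentiable functions. -/
noncomputable def pd (i : Fin p) (f : (Fin p → ℝ) → ℝ) : (Fin p → ℝ) → ℝ :=
  fun x => fderiv ℝ f x (Pi.single i 1)

theorem increment_comm (i j : Fin p) (s t : ℝ) (h : (Fin p → ℝ) → ℝ) :
    increment i s (increment j t h) = increment j t (increment i s h) := by
  funext x
  simp only [increment, add_right_comm x (Pi.single i s)]
  ring

theorem HasPartial.hasDerivAt {i : Fin p} {f f' : (Fin p → ℝ) → ℝ} (hf : HasPartial i f f')
    (x : Fin p → ℝ) (s : ℝ) :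
    HasDerivAt (fun s : ℝ => f (x + Pi.single i s)) (f' (x + Pi.single i s)) s := by
  have h := hf (x + Pi.single i s)
  have h2 := HasDerivAt.comp_sub_const (x := s) (a := s) (f := fun u : ℝ =>
    f (x + Pi.single i s + Pi.single i u)) (f' := f' (x + Pi.single i s)) (by simpa using h)
  refine h2.congr_of_eventuallyEq (Filter.Eventually.of_forall fun u => ?_)
  simp [add_assoc, ← Pi.single_add]

theorem HasPartial.abs_increment_le {i : Fin p} {f f' : (Fin p → ℝ) → ℝ}
    (hf : HasPartial i f f') {C : ℝ} (hC : ∀ x, |f' x| ≤ C) (s : ℝ) (x : Fin p → ℝ) :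
    |increment i s f x| ≤ C * |s| := by
  have := convex_univ.norm_image_sub_le_of_norm_hasDerivWithin_le (C := C)
    (fun u _ => (hf.hasDerivAt x u).hasDerivWithinAt) (fun u _ => by simpa using hC _)
    (Set.mem_univ (0 : ℝ)) (Set.mem_univ s)
  simpa [increment] using this

theorem HasPartial.increment {i : Fin p} {f f' : (Fin p → ℝ) → ℝ} (hf : HasPartial i f f')
    (j : Fin p) (t : ℝ) : HasPartial i (increment j t f) (increment j t f') := by
  intro x
  have h := (hf (x + Pi.single j t)).sub (hf x)
  refine h.congr_of_eventuallyEq (Filter.Eventually.of_forall fun u => ?_)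
  simp [NegAssoc.increment, add_right_comm x (Pi.single i u)]

theorem HasPartial.abs_le_of_increment {i : Fin p} {f f' : (Fin p → ℝ) → ℝ}
    (hf : HasPartial i f f') {C : ℝ} {x : Fin p → ℝ}
    (hC : ∀ s, |NegAssoc.increment i s f x| ≤ C * |s|) : |f' x| ≤ C := by
  have hC0 : 0 ≤ C := by simpa using (abs_nonneg _).trans (hC 1)
  have h := hf x
  refine h.le_of_lip' hC0 (Filter.Eventually.of_forall fun s => ?_)
  simpa [NegAssoc.increment] using hC s

theorem hasPartial_pd {f : (Fin p → ℝ) → ℝ} (hf : Differentiable ℝ f) (i : Fin p) :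
    HasPartial i f (pd i f) := by
  intro x
  have h1 : HasDerivAt (fun s : ℝ => x + Pi.single i s) (Pi.single i (1 : ℝ)) 0 := by
    have := (hasDerivAt_single (𝕜 := ℝ) i (0 : ℝ)).const_add x
    simpa using this
  have h2 : HasFDerivAt f (fderiv ℝ f x) (x + Pi.single i (0 : ℝ)) := by
    simpa using (hf x).hasFDerivAt
  exact h2.comp_hasDerivAt (0 : ℝ) h1

theorem contDiff_pd {f : (Fin p → ℝ) → ℝ} (hf : ContDiff ℝ (⊤ : ℕ∞) f) (i : Fin p) :
    ContDiff ℝ (⊤ : ℕ∞) (pd i f) :=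
  (hf.fderiv_right (m := (⊤ : ℕ∞)) (by simp)).clm_apply contDiff_const

/-- A function with bounded partial derivatives is Lipschitz for the `ℓ¹` norm. -/
theorem abs_sub_le_of_abs_pd_le {f : (Fin p → ℝ) → ℝ} (hf : Differentiable ℝ f) {C : ℝ}
    (hC : ∀ i x, |pd i f x| ≤ C) (x y : Fin p → ℝ) : |f x - f y| ≤ C * ∑ i, |x i - y i| := by
  have h : ∀ t : ℝ, HasDerivAt (fun t : ℝ => f (y + t • (x - y)))
      (fderiv ℝ f (y + t • (x - y)) (x - y)) t := fun t => by
    have h1 : HasDerivAt (fun t : ℝ => y + t • (x - y)) (x - y) t := by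
      simpa using ((hasDerivAt_id t).smul_const (x - y)).const_add y
    exact (hf _).hasFDerivAt.comp_hasDerivAt t h1
  have h2 := norm_image_sub_le_of_norm_deriv_le_segment_01' (C := C * ∑ i, |x i - y i|)
    (fun t _ => (h t).hasDerivWithinAt) (fun t _ => ?_)
  · simpa using h2
  · have h3 : x - y = ∑ i, (x i - y i) • (Pi.single i 1 : Fin p → ℝ) := by
      ext j; simp [Finset.sum_apply, Pi.single_apply]
    rw [h3, map_sum, Finset.mul_sum, ← h3]
    refine (norm_sum_le _ _).trans (Finset.sum_le_sum fun i _ => ?_)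
    rw [map_smul, norm_smul, mul_comm, Real.norm_eq_abs, Real.norm_eq_abs]
    exact mul_le_mul_of_nonneg_right (hC i _) (abs_nonneg _)

theorem continuous_of_abs_sub_le {κ : Type*} [Fintype κ] {f : (κ → ℝ) → ℝ} {C : ℝ}
    (hf : ∀ x y, |f x - f y| ≤ C * ∑ k, |x k - y k|) : Continuous f := by
  rw [continuous_iff_continuousAt]
  intro x
  have h0 : Filter.Tendsto (fun y : κ → ℝ => C * ∑ k, |y k - x k|) (nhds x) (nhds 0) := by
    have : Continuous fun y : κ → ℝ => C * ∑ k, |y k - x k| := by fun_prop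
    simpa using this.tendsto x
  exact tendsto_iff_dist_tendsto_zero.2
    (squeeze_zero (fun _ => dist_nonneg) (fun y => hf y x) h0)

/-! ### The unit ball in terms of increments -/

/-- All iterated increments of order at most three are bounded as they would be if all partial
derivatives of order at most three existed, in any order of differentiation, and were bounded
by one. In contrast to `smoothBall`, this is symmetric in the directions and passes to
convolutions. -/
structure HasBoundedIncrements (h : (Fin p → ℝ) → ℝ) : Prop where
  zero : ∀ x, |h x| ≤ 1
  one : ∀ i s x, |increment i s h x| ≤ |s|
  two : ∀ i j s t x, |increment i s (increment j t h) x| ≤ |s| * |t|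
  three : ∀ i j k s t u x,
    |increment i s (increment j t (increment k u h)) x| ≤ |s| * |t| * |u|

theorem hasPartial_partialDeriv {i : Fin p} {f : (Fin p → ℝ) → ℝ}
    (hf : ∀ x, DifferentiableAt ℝ (slice i f x) (x i)) : HasPartial i f (partialDeriv i f) := by
  intro x
  have h := (hf x).hasDerivAt
  have h2 := HasDerivAt.comp_const_add (x := (0 : ℝ)) (a := x i) (f := slice i f x)
    (f' := partialDeriv i f x) (by rw [add_zero]; exact h)
  refine h2.congr_of_eventuallyEq (Filter.Eventually.of_forall fun u => ?_)
  simp only [slice]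
  congr 1
  ext j
  by_cases hj : j = i
  · subst hj; simp
  · simp [hj]

/-- Raising the exponent of a direction `i` before which no differentiation takes place applies
one more outermost partial derivative; stated for a sorted list of directions. -/
theorem foldr_partialDeriv_add_single (l : List (Fin p)) (hl : l.Pairwise (· < ·))
    (k : Fin p → ℕ) (i : Fin p) (hi : i ∈ l) (hk : ∀ j, j < i → k j = 0)
    (h : (Fin p → ℝ) → ℝ) :
    l.foldr (fun a g => (partialDeriv a)^[(k + Pi.single i 1 : Fin p → ℕ) a] g) h
      = partialDeriv i (l.foldr (fun a g => (partialDeriv a)^[k a] g) h) := by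
  induction l with
  | nil => simp at hi
  | cons a l ih =>
    rw [List.pairwise_cons] at hl
    simp only [List.foldr_cons]
    by_cases hai : a = i
    · subst hai
      have : l.foldr (fun b g => (partialDeriv b)^[(k + Pi.single a 1 : Fin p → ℕ) b] g) h
          = l.foldr (fun b g => (partialDeriv b)^[k b] g) h := by
        refine List.foldr_ext _ _ _ fun b hb g => ?_
        have hne : b ≠ a := (hl.1 b hb).ne'
        simp [hne]
      rw [this]
      simp [Function.iterate_succ_apply']
    · have hil : i ∈ l := by simpa [Ne.symm hai] using hi
      rw [ih hl.2 hil]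
      have hka := hk a (hl.1 i hil)
      simp [hai, hka]

theorem multiDeriv_add_single (k : Fin p → ℕ) (i : Fin p) (hk : ∀ j, j < i → k j = 0)
    (h : (Fin p → ℝ) → ℝ) :
    multiDeriv (k + Pi.single i 1) h = partialDeriv i (multiDeriv k h) :=
  foldr_partialDeriv_add_single _ (List.pairwise_lt_finRange p) k i (List.mem_finRange i) hk h

theorem abs_multiDeriv_le_one {m : ℕ} {h : (Fin p → ℝ) → ℝ} (hh : h ∈ smoothBall m p)
    {k : Fin p → ℕ} (hk : ∑ j, k j ≤ m) (x : Fin p → ℝ) : |multiDeriv k h x| ≤ 1 := by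
  have h1 : ENNReal.ofReal |multiDeriv k h x| ≤ smoothNorm m h := by
    unfold smoothNorm
    exact le_iSup_of_le k (le_iSup_of_le hk (le_iSup_of_le x le_rfl))
  simpa using h1.trans hh.2

theorem hasPartial_multiDeriv {m : ℕ} {h : (Fin p → ℝ) → ℝ} (hh : h ∈ smoothBall m p)
    {k : Fin p → ℕ} (hk : (∑ j, k j) + 1 ≤ m) {i : Fin p} (hi : ∀ j, j < i → k j = 0) :
    HasPartial i (multiDeriv k h) (multiDeriv (k + Pi.single i 1) h) := by
  rw [multiDeriv_add_single k i hi]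
  exact hasPartial_partialDeriv (hh.1.1 k i hk hi)

/-- Nothing is assumed about mixed derivatives taken in the other order, nor about continuity, but
increments commute, so the mean value theorem may be applied in the order in which the derivatives
are known to exist. -/
theorem hasBoundedIncrements_of_mem_smoothBall {h : (Fin p → ℝ) → ℝ}
    (hh : h ∈ smoothBall 3 p) : HasBoundedIncrements h := by
  have e1 (i : Fin p) : ∑ j, (0 + Pi.single i 1 : Fin p → ℕ) j = 1 := by simp
  have e2 (i j : Fin p) : ∑ l, (0 + Pi.single i 1 + Pi.single j 1 : Fin p → ℕ) l = 2 := by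
    simp [Finset.sum_add_distrib]
  have e3 (i j k : Fin p) :
      ∑ l, (0 + Pi.single i 1 + Pi.single j 1 + Pi.single k 1 : Fin p → ℕ) l = 3 := by
    simp [Finset.sum_add_distrib]
  have d1 (i : Fin p) : HasPartial i h (multiDeriv (0 + Pi.single i 1) h) := by
    have := hasPartial_multiDeriv hh (k := 0) (by simp) (i := i) (by simp)
    rwa [multiDeriv_zero] at this
  have d2 (i j : Fin p) (hij : i ≤ j) : HasPartial i (multiDeriv (0 + Pi.single j 1) h)
      (multiDeriv (0 + Pi.single j 1 + Pi.single i 1) h) :=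
    hasPartial_multiDeriv hh (by rw [e1]; norm_num) fun l hl => by
      simp [(hl.trans_le hij).ne]
  have d3 (i j k : Fin p) (hij : i ≤ j) (hjk : j ≤ k) :
      HasPartial i (multiDeriv (0 + Pi.single k 1 + Pi.single j 1) h)
      (multiDeriv (0 + Pi.single k 1 + Pi.single j 1 + Pi.single i 1) h) :=
    hasPartial_multiDeriv hh (by rw [e2]) fun l hl => by
      simp [(hl.trans_le hij).ne, (hl.trans_le (hij.trans hjk)).ne]
  have two (i j : Fin p) (hij : i ≤ j) (s t : ℝ) (x : Fin p → ℝ) :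
      |increment i s (increment j t h) x| ≤ |s| * |t| := by
    have b1 := (d2 i j hij).abs_increment_le
      (fun x => abs_multiDeriv_le_one hh (by rw [e2]; norm_num) x) s
    exact ((d1 j).increment i s).abs_increment_le b1 t x |>.trans_eq' (by rw [increment_comm])
      |>.trans_eq (by ring)
  have three (i j k : Fin p) (hij : i ≤ j) (hjk : j ≤ k) (s t u : ℝ) (x : Fin p → ℝ) :
      |increment i s (increment j t (increment k u h)) x| ≤ |s| * |t| * |u| := by
    have b1 := (d3 i j k hij hjk).abs_increment_le
      (fun x => abs_multiDeriv_le_one hh (by rw [e3]) x) s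
    have b2 := ((d2 j k hjk).increment i s).abs_increment_le b1 t
    have b3 := (((d1 k).increment i s).increment j t).abs_increment_le b2 u x
    rw [increment_comm j k t u, increment_comm i k, increment_comm i j]
    exact b3.trans_eq (by ring)
  refine ⟨fun x => abs_le_one_of_mem_smoothBall hh x, fun i s x => ?_, fun i j s t x => ?_,
    fun i j k s t u x => ?_⟩
  · simpa using (d1 i).abs_increment_le
      (fun x => abs_multiDeriv_le_one hh (by rw [e1]; norm_num) x) s x
  · rcases le_total i j with hij | hij
    · exact two i j hij s t x
    · rw [increment_comm, mul_comm]; exact two j i hij t s x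
  · rcases le_total i j with hij | hij <;> rcases le_total j k with hjk | hjk <;>
      rcases le_total i k with hik | hik
    · exact three i j k hij hjk s t u x
    · exact three i j k hij hjk s t u x
    · rw [increment_comm j k]
      exact (three i k j hik hjk s u t x).trans_eq (by ring)
    · rw [increment_comm j k, increment_comm i k]
      exact (three k i j hik hij u s t x).trans_eq (by ring)
    · rw [increment_comm i j]
      exact (three j i k hij hik t s u x).trans_eq (by ring)
    · rw [increment_comm i j, increment_comm i k]
      exact (three j k i hjk hik t u s x).trans_eq (by ring)
    · rw [increment_comm j k, increment_comm i k, increment_comm i j]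
      exact (three k j i hjk hij u t s x).trans_eq (by ring)
    · rw [increment_comm j k, increment_comm i k, increment_comm i j]
      exact (three k j i hjk hij u t s x).trans_eq (by ring)

/-! ### Smooth approximation -/

/-- Smooth functions whose partial derivatives of order at most three are bounded by one. -/
structure IsSmoothUnit (h : (Fin p → ℝ) → ℝ) : Prop where
  contDiff : ContDiff ℝ (⊤ : ℕ∞) h
  zero : ∀ x, |h x| ≤ 1
  one : ∀ i x, |pd i h x| ≤ 1
  two : ∀ i j x, |pd i (pd j h) x| ≤ 1
  three : ∀ i j k x, |pd i (pd j (pd k h)) x| ≤ 1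

theorem HasBoundedIncrements.isSmoothUnit {h : (Fin p → ℝ) → ℝ} (hh : HasBoundedIncrements h)
    (hc : ContDiff ℝ (⊤ : ℕ∞) h) : IsSmoothUnit h := by
  have D {f : (Fin p → ℝ) → ℝ} (hf : ContDiff ℝ (⊤ : ℕ∞) f) (i : Fin p) : HasPartial i f (pd i f) :=
    hasPartial_pd (hf.differentiable (by simp)) i
  have one (i : Fin p) (x) : |pd i h x| ≤ 1 :=
    (D hc i).abs_le_of_increment fun s => by simpa using hh.one i s x
  have two' (i j : Fin p) (s x) : |increment i s (pd j h) x| ≤ |s| :=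
    ((D hc j).increment i s).abs_le_of_increment fun t => by
      rw [increment_comm]; exact hh.two i j s t x
  have three' (i j k : Fin p) (s t x) : |increment i s (increment j t (pd k h)) x| ≤ |s| * |t| :=
    (((D hc k).increment j t).increment i s).abs_le_of_increment fun u => by
      rw [increment_comm k i, increment_comm k j]; exact hh.three i j k s t u x
  have three'' (i j k : Fin p) (s x) : |increment i s (pd j (pd k h)) x| ≤ |s| :=
    ((D (contDiff_pd hc k) j).increment i s).abs_le_of_increment fun t => by
      rw [increment_comm]; exact three' i j k s t x
  exact ⟨hc, hh.zero, one,
    fun i j x => (D (contDiff_pd hc j) i).abs_le_of_increment fun s => by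
      simpa using two' i j s x,
    fun i j k x => (D (contDiff_pd (contDiff_pd hc k) j) i).abs_le_of_increment fun s => by
      simpa using three'' i j k s x⟩

theorem HasBoundedIncrements.abs_sub_le {h : (Fin p → ℝ) → ℝ} (hh : HasBoundedIncrements h)
    (x y : Fin p → ℝ) : |h x - h y| ≤ ∑ i, |x i - y i| := by
  have key : ∀ s : Finset (Fin p), |h (y + ∑ i ∈ s, Pi.single i (x i - y i)) - h y|
      ≤ ∑ i ∈ s, |x i - y i| := by
    intro s
    induction s using Finset.induction_on with
    | empty => simp
    | insert a s ha ih =>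
      rw [Finset.sum_insert ha, Finset.sum_insert ha]
      have h1 := hh.one a (x a - y a) (y + ∑ i ∈ s, Pi.single i (x i - y i))
      rw [increment, add_assoc, add_comm (∑ i ∈ s, _)] at h1
      calc _ = |(h (y + (Pi.single a (x a - y a) + ∑ i ∈ s, Pi.single i (x i - y i)))
              - h (y + ∑ i ∈ s, Pi.single i (x i - y i)))
              + (h (y + ∑ i ∈ s, Pi.single i (x i - y i)) - h y)| := by congr 1; ring
        _ ≤ _ := (abs_add_le _ _).trans (add_le_add h1 ih)
  have h2 := key Finset.univ
  have h3 : y + ∑ i, Pi.single i (x i - y i) = x := by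
    ext j; simp [Finset.sum_apply, Pi.single_apply]
  rwa [h3] at h2

theorem HasBoundedIncrements.continuous {h : (Fin p → ℝ) → ℝ} (hh : HasBoundedIncrements h) :
    Continuous h :=
  continuous_of_abs_sub_le (C := 1) fun x y => by rw [one_mul]; exact hh.abs_sub_le x y

section Mollify

variable (φ : ContDiffBump (0 : Fin p → ℝ))

/-- The convolution of `h` with the normalised bump function `φ`. -/
noncomputable def mollify (h : (Fin p → ℝ) → ℝ) : (Fin p → ℝ) → ℝ :=
  convolution (φ.normed volume) h (ContinuousLinearMap.lsmul ℝ ℝ) volume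

theorem mollify_apply (h : (Fin p → ℝ) → ℝ) (x : Fin p → ℝ) :
    mollify φ h x = ∫ t, φ.normed volume t * h (x - t) := by
  simp [mollify, convolution]

theorem integrable_mollify {h : (Fin p → ℝ) → ℝ} (hc : Continuous h) (x : Fin p → ℝ) :
    Integrable fun t => φ.normed volume t * h (x - t) :=
  (φ.continuous_normed.mul (by fun_prop)).integrable_of_hasCompactSupport
    φ.hasCompactSupport_normed.mul_right

theorem increment_mollify {h : (Fin p → ℝ) → ℝ} (hc : Continuous h) (i : Fin p) (s : ℝ) :
    increment i s (mollify φ h) = mollify φ (increment i s h) := by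
  funext x
  simp only [increment, mollify_apply]
  rw [← integral_sub (integrable_mollify φ hc _) (integrable_mollify φ hc _)]
  congr 1 with t
  rw [mul_sub, sub_add_eq_add_sub]

theorem continuous_increment {h : (Fin p → ℝ) → ℝ} (hc : Continuous h) (i : Fin p) (s : ℝ) :
    Continuous (increment i s h) := by
  unfold increment
  fun_prop

theorem abs_mollify_le {h : (Fin p → ℝ) → ℝ} {C : ℝ} (hC : ∀ x, |h x| ≤ C) (x : Fin p → ℝ) :
    |mollify φ h x| ≤ C := by
  rw [mollify_apply]
  have hb (t : Fin p → ℝ) : ‖φ.normed volume t * h (x - t)‖ ≤ φ.normed volume t * C := by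
    rw [norm_mul, Real.norm_of_nonneg (φ.nonneg_normed t)]
    exact mul_le_mul_of_nonneg_left (hC _) (φ.nonneg_normed t)
  calc |∫ t, φ.normed volume t * h (x - t)| ≤ ∫ t, φ.normed volume t * C :=
        norm_integral_le_of_norm_le (φ.integrable_normed.mul_const C)
          (Filter.Eventually.of_forall hb)
    _ = C := by rw [integral_mul_const, φ.integral_normed, one_mul]

theorem HasBoundedIncrements.isSmoothUnit_mollify {h : (Fin p → ℝ) → ℝ}
    (hh : HasBoundedIncrements h) : IsSmoothUnit (mollify φ h) := by
  have c0 := hh.continuous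
  refine HasBoundedIncrements.isSmoothUnit ⟨fun x => abs_mollify_le φ hh.zero x,
    fun i s x => ?_, fun i j s t x => ?_, fun i j k s t u x => ?_⟩
    (φ.hasCompactSupport_normed.contDiff_convolution_left _ φ.contDiff_normed
      c0.locallyIntegrable)
  · rw [show increment i s _ = _ from increment_mollify φ c0 i s]
    exact abs_mollify_le φ (hh.one i s) x
  · rw [increment_mollify φ c0, increment_mollify φ (continuous_increment c0 _ _)]
    exact abs_mollify_le φ (hh.two i j s t) x
  · rw [increment_mollify φ c0, increment_mollify φ (continuous_increment c0 _ _),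
      increment_mollify φ (continuous_increment (continuous_increment c0 _ _) _ _)]
    exact abs_mollify_le φ (hh.three i j k s t u) x

end Mollify

theorem HasBoundedIncrements.exists_isSmoothUnit {h : (Fin p → ℝ) → ℝ}
    (hh : HasBoundedIncrements h) {ε : ℝ} (hε : 0 < ε) :
    ∃ f, IsSmoothUnit f ∧ ∀ x, |f x - h x| ≤ ε := by
  have hp : (0 : ℝ) < p + 1 := by positivity
  have hr : 0 < ε / (p + 1) := by positivity
  let φ : ContDiffBump (0 : Fin p → ℝ) := ⟨ε / (p + 1) / 2, ε / (p + 1), by positivity, by linarith⟩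
  refine ⟨mollify φ h, hh.isSmoothUnit_mollify φ, fun x => ?_⟩
  refine φ.dist_normed_convolution_le hh.continuous.aestronglyMeasurable fun y hy => ?_
  refine (hh.abs_sub_le y x).trans ?_
  have h1 : ∀ i, |y i - x i| ≤ ε / (p + 1) := fun i =>
    (dist_le_pi_dist y x i).trans (Metric.mem_ball.1 hy).le
  calc ∑ i, |y i - x i| ≤ ∑ _i : Fin p, ε / (p + 1) := Finset.sum_le_sum fun i _ => h1 i
    _ = p * (ε / (p + 1)) := by simp
    _ ≤ (p + 1) * (ε / (p + 1)) := by gcongr; linarith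
    _ = ε := by field_simp

/-! ### Gaussian integration by parts -/

theorem gaussianPDFReal_zero_one (x : ℝ) :
    gaussianPDFReal 0 1 x = (√(2 * Real.pi))⁻¹ * Real.exp (-(1 / 2) * x ^ 2) := by
  simp only [gaussianPDFReal, NNReal.coe_one, mul_one, sub_zero]
  congr 2
  ring

theorem integral_mul_gaussianReal_eq_integral_deriv {f f' : ℝ → ℝ} {C C' : ℝ}
    (hf : ∀ x, HasDerivAt f (f' x) x) (hfm : Continuous f') (hC : ∀ x, |f x| ≤ C)
    (hC' : ∀ x, |f' x| ≤ C') :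
    ∫ x, x * f x ∂gaussianReal 0 1 = ∫ x, f' x ∂gaussianReal 0 1 := by
  have hfc : Continuous f := continuous_iff_continuousAt.2 fun x => (hf x).continuousAt
  have hd (x : ℝ) : HasDerivAt (gaussianPDFReal 0 1) (-(x * gaussianPDFReal 0 1 x)) x := by
    rw [show gaussianPDFReal 0 1 = fun x => (√(2 * Real.pi))⁻¹ * Real.exp (-(1 / 2) * x ^ 2) from
      funext gaussianPDFReal_zero_one]
    refine (((hasDerivAt_pow 2 x).const_mul (-(1 / 2) : ℝ)).exp.const_mul
      (√(2 * Real.pi))⁻¹).congr_deriv ?_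
    push_cast
    ring
  have i0 : Integrable (gaussianPDFReal 0 1) := integrable_gaussianPDFReal 0 1
  have i1 : Integrable fun x => x * gaussianPDFReal 0 1 x := by
    have := (integrable_mul_exp_neg_mul_sq (b := 1 / 2) (by norm_num)).const_mul
      (√(2 * Real.pi))⁻¹
    refine this.congr (Filter.Eventually.of_forall fun x => ?_)
    simp only [gaussianPDFReal_zero_one]
    ring
  have key := integral_mul_deriv_eq_deriv_mul_of_integrable (u := f) (v := gaussianPDFReal 0 1)
    (fun x _ => hf x) (fun x _ => hd x)
    (i1.neg.bdd_mul (c := C) hfc.aestronglyMeasurable (Filter.Eventually.of_forall hC))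
    (i0.bdd_mul (c := C') hfm.aestronglyMeasurable (Filter.Eventually.of_forall hC'))
    (i0.bdd_mul (c := C) hfc.aestronglyMeasurable (Filter.Eventually.of_forall hC))
  rw [integral_gaussianReal_eq_integral_smul one_ne_zero,
    integral_gaussianReal_eq_integral_smul one_ne_zero]
  calc ∫ x, gaussianPDFReal 0 1 x • (x * f x)
      = -∫ x, f x * (-(x * gaussianPDFReal 0 1 x)) := by
        rw [← integral_neg]; congr 1 with x; simp only [smul_eq_mul]; ring
    _ = ∫ x, gaussianPDFReal 0 1 x • f' x := by
        rw [key, neg_neg]; congr 1 with x; simp only [smul_eq_mul]; ring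

instance isProbabilityMeasure_stdNormal : IsProbabilityMeasure (stdNormal p) := by
  unfold stdNormal; infer_instance

theorem integrable_coord_stdNormal (i : Fin p) :
    Integrable (fun z : Fin p → ℝ => z i) (stdNormal p) := by
  have h := (memLp_id_gaussianReal (μ := 0) (v := 1) 1).integrable (by simp)
  exact (measurePreserving_eval (fun _ : Fin p => gaussianReal 0 1) i).integrable_comp_of_integrable
    h

theorem integral_mul_stdNormal_eq_integral_partial {i : Fin p} {f f' : (Fin p → ℝ) → ℝ}
    {C C' : ℝ} (hf : HasPartial i f f') (hfc : Continuous f) (hfc' : Continuous f')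
    (hC : ∀ x, |f x| ≤ C) (hC' : ∀ x, |f' x| ≤ C') :
    ∫ z, z i * f z ∂stdNormal p = ∫ z, f' z ∂stdNormal p := by
  obtain _ | n := p
  · exact i.elim0
  have mp := (measurePreserving_piFinSuccAbove (fun _ : Fin (n + 1) => gaussianReal 0 1) i).symm
  have i1 : Integrable (fun z : Fin (n + 1) → ℝ => z i * f z) (stdNormal (n + 1)) :=
    (integrable_coord_stdNormal i).mul_bdd (c := C) hfc.aestronglyMeasurable
      (Filter.Eventually.of_forall hC)
  have i2 : Integrable f' (stdNormal (n + 1)) :=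
    Integrable.of_bound hfc'.aestronglyMeasurable C' (Filter.Eventually.of_forall hC')
  have e (g : (Fin (n + 1) → ℝ) → ℝ) (hg : Integrable g (stdNormal (n + 1))) :
      ∫ z, g z ∂stdNormal (n + 1) = ∫ y : Fin n → ℝ, ∫ x : ℝ, g (i.insertNth x y)
        ∂gaussianReal 0 1 ∂(Measure.pi fun _ => gaussianReal 0 1) := by
    have h1 := mp.integral_comp' g
    have h2 : Integrable (fun q : ℝ × (Fin n → ℝ) => g (i.insertNth q.1 q.2))
        ((gaussianReal 0 1).prod (Measure.pi fun _ => gaussianReal 0 1)) :=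
      mp.integrable_comp_of_integrable hg
    rw [stdNormal, ← h1]
    exact integral_prod_symm _ h2
  rw [e _ i1, e _ i2]
  congr 1 with y
  obtain ⟨v, hv⟩ : ∃ v : Fin (n + 1) → ℝ, ∀ x : ℝ,
      (i.insertNth x y : Fin (n + 1) → ℝ) = v + Pi.single i x := by
    refine ⟨i.insertNth 0 y, fun x => ?_⟩
    ext j
    refine Fin.succAboveCases i ?_ (fun k => ?_) j
    · simp
    · simp only [Fin.insertNth_apply_succAbove, Pi.add_apply,
        Pi.single_eq_of_ne (Fin.succAbove_ne i k), add_zero]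
  have hs : Continuous fun x : ℝ => (Pi.single i x : Fin (n + 1) → ℝ) :=
    continuous_pi fun j => by simp only [Pi.single_apply]; split_ifs <;> fun_prop
  simp_rw [Fin.insertNth_apply_same, hv]
  exact integral_mul_gaussianReal_eq_integral_deriv (fun x => hf.hasDerivAt _ x)
    (hfc'.comp (continuous_const.add hs)) (fun x => hC _) (fun x => hC' _)

/-! ### Gaussian interpolation -/

theorem pd_comp_smul_add {h : (Fin p → ℝ) → ℝ} (hh : Differentiable ℝ h) (s : ℝ)
    (v : Fin p → ℝ) (i : Fin p) :
    pd i (fun w => h (s • w + v)) = fun w => s * pd i h (s • w + v) := by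
  funext w
  have h1 : HasFDerivAt (fun w : Fin p → ℝ => s • w + v)
      (s • ContinuousLinearMap.id ℝ (Fin p → ℝ)) w :=
    (s • ContinuousLinearMap.id ℝ (Fin p → ℝ)).hasFDerivAt.add_const v
  have h2 := (hh (s • w + v)).hasFDerivAt.comp w h1
  simp only [pd]
  rw [show (fun w => h (s • w + v)) = h ∘ fun w => s • w + v from rfl, h2.fderiv]
  simp

theorem pd_const_mul {f : (Fin p → ℝ) → ℝ} (hf : Differentiable ℝ f) (c : ℝ) (i : Fin p) :
    pd i (fun w => c * f w) = fun w => c * pd i f w := by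
  funext w
  simp only [pd]
  rw [fderiv_const_mul (hf w)]
  simp

/-- The Stein operator of the standard normal law, `w ↦ ⟨w, ∇F w⟩ - ΔF w`. -/
noncomputable def steinOp (F : (Fin p → ℝ) → ℝ) (w : Fin p → ℝ) : ℝ :=
  ∑ i, w i * pd i F w - ∑ i, pd i (pd i F) w

theorem pd_pd_comp_smul_add {h : (Fin p → ℝ) → ℝ} (hh : ContDiff ℝ (⊤ : ℕ∞) h) (s : ℝ)
    (v : Fin p → ℝ) (i j : Fin p) :
    pd i (pd j fun w => h (s • w + v)) = fun w => s ^ 2 * pd i (pd j h) (s • w + v) := by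
  have d1 := (contDiff_pd hh j).differentiable (by simp)
  have d2 : Differentiable ℝ fun w => pd j h (s • w + v) := d1.comp (by fun_prop)
  rw [pd_comp_smul_add (hh.differentiable (by simp)), pd_const_mul d2, pd_comp_smul_add d1]
  funext w
  ring

theorem pd_pd_pd_comp_smul_add {h : (Fin p → ℝ) → ℝ} (hh : ContDiff ℝ (⊤ : ℕ∞) h) (s : ℝ)
    (v : Fin p → ℝ) (i j k : Fin p) :
    pd i (pd j (pd k fun w => h (s • w + v)))
      = fun w => s ^ 3 * pd i (pd j (pd k h)) (s • w + v) := by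
  have d1 := (contDiff_pd (contDiff_pd hh k) j).differentiable (by simp)
  have d2 : Differentiable ℝ fun w => pd j (pd k h) (s • w + v) := d1.comp (by fun_prop)
  rw [pd_pd_comp_smul_add hh, pd_const_mul d2, pd_comp_smul_add d1]
  funext w
  ring

section Interpolation

variable {ν : Measure (Fin p → ℝ)} [IsProbabilityMeasure ν] {h : (Fin p → ℝ) → ℝ}

theorem hasDerivAt_interpolation (hν : ∀ i, Integrable (fun w : Fin p → ℝ => w i) ν)
    (hh : IsSmoothUnit h) (θ : ℝ) :
    HasDerivAt (fun θ => ∫ q, h (Real.sin θ • q.1 + Real.cos θ • q.2) ∂ν.prod (stdNormal p))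
      (∫ q, ∑ i, (Real.cos θ * q.1 i - Real.sin θ * q.2 i)
        * pd i h (Real.sin θ • q.1 + Real.cos θ • q.2) ∂ν.prod (stdNormal p)) θ := by
  have hc := hh.contDiff.continuous
  have hc1 (i : Fin p) := (contDiff_pd hh.contDiff i).continuous
  refine (hasDerivAt_integral_of_dominated_loc_of_deriv_le (s := Set.univ)
    (F := fun θ (q : (Fin p → ℝ) × (Fin p → ℝ)) => h (Real.sin θ • q.1 + Real.cos θ • q.2))
    (F' := fun θ q => ∑ i, (Real.cos θ * q.1 i - Real.sin θ * q.2 i)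
      * pd i h (Real.sin θ • q.1 + Real.cos θ • q.2))
    (bound := fun q : (Fin p → ℝ) × (Fin p → ℝ) => ∑ i, (|q.1 i| + |q.2 i|)) Filter.univ_mem
    (Filter.Eventually.of_forall fun θ => ?_) ?_ ?_ (Filter.Eventually.of_forall fun q θ _ => ?_)
    ?_ (Filter.Eventually.of_forall fun q θ _ => ?_)).2
  · exact Continuous.aestronglyMeasurable (by fun_prop)
  · exact Integrable.of_bound (Continuous.aestronglyMeasurable (by fun_prop)) 1
      (Filter.Eventually.of_forall fun q => hh.zero _)
  · exact Continuous.aestronglyMeasurable (by fun_prop)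
  · refine (norm_sum_le _ _).trans (Finset.sum_le_sum fun i _ => ?_)
    rw [norm_mul]
    calc _ ≤ ‖Real.cos θ * q.1 i - Real.sin θ * q.2 i‖ * 1 :=
          mul_le_mul_of_nonneg_left (hh.one i _) (norm_nonneg _)
      _ ≤ |Real.cos θ| * |q.1 i| + |Real.sin θ| * |q.2 i| := by
          rw [mul_one, ← abs_mul, ← abs_mul]; exact abs_sub _ _
      _ ≤ 1 * |q.1 i| + 1 * |q.2 i| := by
          gcongr
          · exact Real.abs_cos_le_one θ
          · exact Real.abs_sin_le_one θ
      _ = _ := by ring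
  · exact integrable_finsetSum _ fun i _ =>
      ((hν i).comp_fst _).abs.add ((integrable_coord_stdNormal i).comp_snd _).abs
  · have h1 : HasDerivAt (fun θ => Real.sin θ • q.1 + Real.cos θ • q.2)
        (Real.cos θ • q.1 + (-Real.sin θ) • q.2) θ :=
      ((Real.hasDerivAt_sin θ).smul_const _).add ((Real.hasDerivAt_cos θ).smul_const _)
    have h2 := (hh.contDiff.differentiable (by simp) _).hasFDerivAt.comp_hasDerivAt θ h1
    refine h2.congr_deriv ?_
    have h3 : Real.cos θ • q.1 + (-Real.sin θ) • q.2
        = ∑ i, (Real.cos θ * q.1 i - Real.sin θ * q.2 i) • (Pi.single i 1 : Fin p → ℝ) := by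
      ext j; simp [Finset.sum_apply, Pi.single_apply, sub_eq_add_neg]
    rw [h3, map_sum]
    simp [pd]

/-- Integrating by parts in the Gaussian variable and then freezing it, the derivative of the
interpolation is an average of Stein operators of `w ↦ h (sin θ • w + cos θ • z)`. The factor
`sin θ` is kept on the left so that no division by zero occurs at `θ = 0`. -/
theorem sin_mul_deriv_interpolation (hν : ∀ i, Integrable (fun w : Fin p → ℝ => w i) ν)
    (hh : IsSmoothUnit h) (θ : ℝ) :
    Real.sin θ * (∫ q, ∑ i, (Real.cos θ * q.1 i - Real.sin θ * q.2 i)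
        * pd i h (Real.sin θ • q.1 + Real.cos θ • q.2) ∂ν.prod (stdNormal p))
      = Real.cos θ * ∫ z, ∫ w, steinOp (fun w => h (Real.sin θ • w + Real.cos θ • z)) w ∂ν
        ∂stdNormal p := by
  set s := Real.sin θ
  set c := Real.cos θ
  have hc1 (i : Fin p) := (contDiff_pd hh.contDiff i).continuous
  have hc2 (i : Fin p) := (contDiff_pd (contDiff_pd hh.contDiff i) i).continuous
  have I1 (i : Fin p) : Integrable (fun q : (Fin p → ℝ) × (Fin p → ℝ) =>
      q.1 i * pd i h (s • q.1 + c • q.2)) (ν.prod (stdNormal p)) :=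
    ((hν i).comp_fst _).mul_bdd (c := 1) (Continuous.aestronglyMeasurable (by fun_prop))
      (Filter.Eventually.of_forall fun q => hh.one i _)
  have I2 (i : Fin p) : Integrable (fun q : (Fin p → ℝ) × (Fin p → ℝ) =>
      q.2 i * pd i h (s • q.1 + c • q.2)) (ν.prod (stdNormal p)) :=
    ((integrable_coord_stdNormal i).comp_snd _).mul_bdd (c := 1)
      (Continuous.aestronglyMeasurable (by fun_prop))
      (Filter.Eventually.of_forall fun q => hh.one i _)
  have I3 (i : Fin p) : Integrable (fun q : (Fin p → ℝ) × (Fin p → ℝ) =>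
      pd i (pd i h) (s • q.1 + c • q.2)) (ν.prod (stdNormal p)) :=
    Integrable.of_bound (Continuous.aestronglyMeasurable (by fun_prop)) 1
      (Filter.Eventually.of_forall fun q => hh.two i i _)
  have ibp (i : Fin p) : ∫ q, q.2 i * pd i h (s • q.1 + c • q.2) ∂ν.prod (stdNormal p)
      = c * ∫ q, pd i (pd i h) (s • q.1 + c • q.2) ∂ν.prod (stdNormal p) := by
    rw [integral_prod _ (I2 i), integral_prod _ (I3 i), ← integral_const_mul]
    congr 1 with w
    have hd := (contDiff_pd hh.contDiff i).differentiable (by simp)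
    have hp := hasPartial_pd (f := fun z => pd i h (c • z + s • w))
      (hd.comp (by fun_prop)) i
    rw [pd_comp_smul_add hd] at hp
    have := integral_mul_stdNormal_eq_integral_partial (C := 1) (C' := |c|) hp (by fun_prop)
      (by fun_prop) (fun x => hh.one i _) (fun x => by
        rw [abs_mul]
        exact mul_le_of_le_one_right (abs_nonneg _) (hh.two i i _))
    rw [integral_const_mul] at this
    simpa only [add_comm] using this
  have L : ∫ q, ∑ i, (c * q.1 i - s * q.2 i) * pd i h (s • q.1 + c • q.2) ∂ν.prod (stdNormal p)
      = ∑ i, (c * ∫ q, q.1 i * pd i h (s • q.1 + c • q.2) ∂ν.prod (stdNormal p)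
        - s * (c * ∫ q, pd i (pd i h) (s • q.1 + c • q.2) ∂ν.prod (stdNormal p))) := by
    rw [← Finset.sum_congr rfl fun i _ => by rw [← ibp i, ← integral_const_mul,
      ← integral_const_mul, ← integral_sub ((I1 i).const_mul c) ((I2 i).const_mul s)]]
    rw [integral_finsetSum]
    · exact Finset.sum_congr rfl fun i _ => by congr 1 with q; ring
    · intro i _
      refine (((I1 i).const_mul c).sub ((I2 i).const_mul s)).congr
        (Filter.Eventually.of_forall fun q => ?_)
      simp only [Pi.sub_apply]
      ring
  have R : ∫ z, ∫ w, steinOp (fun w => h (s • w + c • z)) w ∂ν ∂stdNormal p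
      = ∑ i, (s * ∫ q, q.1 i * pd i h (s • q.1 + c • q.2) ∂ν.prod (stdNormal p)
        - s ^ 2 * ∫ q, pd i (pd i h) (s • q.1 + c • q.2) ∂ν.prod (stdNormal p)) := by
    have hs (z w : Fin p → ℝ) : steinOp (fun w => h (s • w + c • z)) w
        = ∑ i, (s * (w i * pd i h (s • w + c • z)) - s ^ 2 * pd i (pd i h) (s • w + c • z)) := by
      rw [steinOp, ← Finset.sum_sub_distrib]
      refine Finset.sum_congr rfl fun i _ => ?_
      rw [pd_pd_comp_smul_add hh.contDiff,
        pd_comp_smul_add (hh.contDiff.differentiable (by simp))]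
      ring
    simp_rw [hs]
    have I4 (i : Fin p) : Integrable (fun q : (Fin p → ℝ) × (Fin p → ℝ) =>
        s * (q.1 i * pd i h (s • q.1 + c • q.2)) - s ^ 2 * pd i (pd i h) (s • q.1 + c • q.2))
        (ν.prod (stdNormal p)) := ((I1 i).const_mul s).sub ((I3 i).const_mul (s ^ 2))
    rw [← integral_prod_symm (fun q : (Fin p → ℝ) × (Fin p → ℝ) =>
      ∑ i, (s * (q.1 i * pd i h (s • q.1 + c • q.2)) - s ^ 2 * pd i (pd i h) (s • q.1 + c • q.2)))
      (integrable_finsetSum _ fun i _ => I4 i)]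
    rw [integral_finsetSum _ fun i _ => I4 i]
    refine Finset.sum_congr rfl fun i _ => ?_
    rw [← integral_const_mul, ← integral_const_mul]
    exact integral_sub ((I1 i).const_mul s) ((I3 i).const_mul (s ^ 2))
  rw [L, R, Finset.mul_sum, Finset.mul_sum]
  exact Finset.sum_congr rfl fun i _ => by ring

/-- A bound on the Stein discrepancy of `ν` that is linear in the sizes of the second and third
partial derivatives bounds the distance to the normal law: with `U θ` the interpolation,
`|U' θ| ≤ cos θ (A₂ sin θ + A₃ sin² θ)`. -/
theorem abs_integral_sub_stdNormal_le (hν : ∀ i, Integrable (fun w : Fin p → ℝ => w i) ν)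
    {A₂ A₃ : ℝ}
    (hS : ∀ (F : (Fin p → ℝ) → ℝ) (c₂ c₃ : ℝ), ContDiff ℝ (⊤ : ℕ∞) F →
      (∀ i j x, |pd i (pd j F) x| ≤ c₂) → (∀ i j k x, |pd i (pd j (pd k F)) x| ≤ c₃) →
      0 ≤ c₂ → 0 ≤ c₃ → |∫ w, steinOp F w ∂ν| ≤ A₂ * c₂ + A₃ * c₃)
    (hh : IsSmoothUnit h) :
    |∫ w, h w ∂ν - ∫ z, h z ∂stdNormal p| ≤ A₂ / 2 + A₃ / 3 := by
  set U : ℝ → ℝ := fun θ => ∫ q, h (Real.sin θ • q.1 + Real.cos θ • q.2) ∂ν.prod (stdNormal p)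
    with hU
  set U' : ℝ → ℝ := fun θ => ∫ q, ∑ i, (Real.cos θ * q.1 i - Real.sin θ * q.2 i)
        * pd i h (Real.sin θ • q.1 + Real.cos θ • q.2) ∂ν.prod (stdNormal p) with hU'
  have dU (θ : ℝ) : HasDerivAt U (U' θ) θ := hasDerivAt_interpolation hν hh θ
  have bU (θ : ℝ) (h0 : 0 < θ) (h1 : θ < Real.pi / 2) :
      |U' θ| ≤ Real.cos θ * (A₂ * Real.sin θ + A₃ * Real.sin θ ^ 2) := by
    have hs : 0 < Real.sin θ := Real.sin_pos_of_pos_of_lt_pi h0 (by linarith [Real.pi_pos])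
    have hc : 0 < Real.cos θ := Real.cos_pos_of_mem_Ioo ⟨by linarith, h1⟩
    have key : |∫ z, ∫ w, steinOp (fun w => h (Real.sin θ • w + Real.cos θ • z)) w ∂ν
        ∂stdNormal p| ≤ A₂ * Real.sin θ ^ 2 + A₃ * Real.sin θ ^ 3 := by
      have := norm_integral_le_of_norm_le_const (μ := stdNormal p)
        (f := fun z => ∫ w, steinOp (fun w => h (Real.sin θ • w + Real.cos θ • z)) w ∂ν)
        (C := A₂ * Real.sin θ ^ 2 + A₃ * Real.sin θ ^ 3)
        (Filter.Eventually.of_forall fun z => hS _ _ _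
          (hh.contDiff.comp (by fun_prop)) (fun i j x => ?_) (fun i j k x => ?_)
          (by positivity) (by positivity))
      · simpa using this
      · rw [pd_pd_comp_smul_add hh.contDiff, abs_mul, abs_of_pos (by positivity)]
        exact mul_le_of_le_one_right (by positivity) (hh.two i j _)
      · rw [pd_pd_pd_comp_smul_add hh.contDiff, abs_mul, abs_of_pos (by positivity)]
        exact mul_le_of_le_one_right (by positivity) (hh.three i j k _)
    have e := congrArg abs (sin_mul_deriv_interpolation hν hh θ)
    rw [abs_mul, abs_mul, abs_of_pos hs, abs_of_pos hc] at e
    refine le_of_mul_le_mul_left ?_ hs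
    calc _ = _ := e
      _ ≤ Real.cos θ * (A₂ * Real.sin θ ^ 2 + A₃ * Real.sin θ ^ 3) := by gcongr
      _ = _ := by ring
  set Φ : ℝ → ℝ := fun θ => A₂ / 2 * Real.sin θ ^ 2 + A₃ / 3 * Real.sin θ ^ 3
  have dΦ (θ : ℝ) : HasDerivAt Φ (Real.cos θ * (A₂ * Real.sin θ + A₃ * Real.sin θ ^ 2)) θ := by
    refine ((((Real.hasDerivAt_sin θ).pow 2).const_mul (A₂ / 2)).add
      (((Real.hasDerivAt_sin θ).pow 3).const_mul (A₃ / 3))).congr_deriv ?_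
    push_cast
    ring
  have anti (σ : ℝ) (hσ : |σ| = 1) : σ * (U (Real.pi / 2) - U 0) ≤ A₂ / 2 + A₃ / 3 := by
    have hd (θ : ℝ) := ((dU θ).const_mul σ).sub (dΦ θ)
    have := antitoneOn_of_deriv_nonpos (convex_Icc 0 (Real.pi / 2))
      (f := fun θ => σ * U θ - Φ θ)
      (fun θ _ => (hd θ).continuousAt.continuousWithinAt)
      (fun θ _ => (hd θ).differentiableAt.differentiableWithinAt) (fun θ hθ => ?_)
      (Set.left_mem_Icc.2 (by positivity)) (Set.right_mem_Icc.2 (by positivity)) (by positivity)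
    · simp only [Φ, Real.sin_pi_div_two, Real.sin_zero] at this
      linarith
    · rw [interior_Icc] at hθ
      rw [show deriv (fun θ => σ * U θ - Φ θ) θ = _ from (hd θ).deriv, sub_nonpos]
      calc σ * U' θ ≤ |σ * U' θ| := le_abs_self _
        _ = |U' θ| := by rw [abs_mul, hσ, one_mul]
        _ ≤ _ := bU θ hθ.1 hθ.2
  have e0 : U 0 = ∫ z, h z ∂stdNormal p := by
    simp only [hU, Real.sin_zero, Real.cos_zero, zero_smul, one_smul, zero_add]
    rw [integral_fun_snd]
    simp
  have e1 : U (Real.pi / 2) = ∫ w, h w ∂ν := by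
    simp only [hU, Real.sin_pi_div_two, Real.cos_pi_div_two, zero_smul, one_smul, add_zero]
    rw [integral_fun_fst]
    simp
  rw [← e0, ← e1, abs_le]
  constructor
  · have := anti (-1) (by simp)
    linarith
  · have := anti 1 (by simp)
    linarith

end Interpolation

/-! ### Almost surely bounded random variables -/

section Bounded

variable {Ω : Type*} [MeasurableSpace Ω] {P : Measure Ω}

/-- `X` is almost everywhere measurable and almost surely bounded by some constant. -/
def IsAEBounded (P : Measure Ω) (X : Ω → ℝ) : Prop :=
  AEMeasurable X P ∧ ∃ C, ∀ᵐ ω ∂P, |X ω| ≤ C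

theorem IsAEBounded.memLp [IsFiniteMeasure P] {X : Ω → ℝ} (hX : IsAEBounded P X) :
    MemLp X 2 P := by
  obtain ⟨h, C, hC⟩ := hX
  exact MemLp.of_bound h.aestronglyMeasurable C hC

theorem IsAEBounded.integrable [IsFiniteMeasure P] {X : Ω → ℝ} (hX : IsAEBounded P X) :
    Integrable X P :=
  hX.memLp.integrable (by norm_num)

theorem IsAEBounded.comp_continuous {κ : Type*} [Fintype κ] {X : Ω → κ → ℝ}
    (hX : ∀ k, IsAEBounded P fun ω => X ω k) {g : (κ → ℝ) → ℝ} (hg : Continuous g) :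
    IsAEBounded P fun ω => g (X ω) := by
  choose hm C hC using hX
  refine ⟨hg.measurable.comp_aemeasurable (aemeasurable_pi_lambda _ hm), ?_⟩
  obtain ⟨D, hD⟩ := (isCompact_closedBall (0 : κ → ℝ) (∑ k, |C k|)).exists_bound_of_continuousOn
    hg.continuousOn
  refine ⟨D, ?_⟩
  filter_upwards [Filter.eventually_all.2 hC] with ω hω
  refine hD _ (mem_closedBall_zero_iff.2
    ((pi_norm_le_iff_of_nonneg (Finset.sum_nonneg fun k _ => abs_nonneg _)).2 fun k => ?_))
  exact ((hω k).trans (le_abs_self _)).trans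
    (Finset.single_le_sum (f := fun k => |C k|) (fun k _ => abs_nonneg _) (Finset.mem_univ k))

theorem IsAEBounded.mul {X Y : Ω → ℝ} (hX : IsAEBounded P X) (hY : IsAEBounded P Y) :
    IsAEBounded P fun ω => X ω * Y ω := by
  refine IsAEBounded.comp_continuous (X := fun ω => ![X ω, Y ω]) (g := fun v => v 0 * v 1)
    (fun k => ?_) (by fun_prop)
  fin_cases k
  · exact hX
  · exact hY

theorem IsAEBounded.comp {X : Ω → ℝ} (hX : IsAEBounded P X) {f : ℝ → ℝ} (hf : Continuous f) :
    IsAEBounded P fun ω => f (X ω) :=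
  IsAEBounded.comp_continuous (X := fun ω (_ : Unit) => X ω) (g := fun v => f (v ()))
    (fun _ => hX) (by fun_prop)

end Bounded

/-! ### Covariances of Lipschitz functions of negatively associated variables -/

section Covariance

variable {Ω : Type*} [MeasurableSpace Ω] {P : Measure Ω} [IsProbabilityMeasure P]

/-- Adding a multiple of the sum of the coordinates makes a Lipschitz function nondecreasing, so
negative association applies to the four pairs `L ξ_a ± f (ξ_a)`, `c ∑ ξ_b ± ψ (ξ)`; adding
these inequalities two by two, the cross terms cancel. -/
theorem NegativelyAssociated.abs_cov_le {ι : Type*} {ξ : ι → Ω → ℝ}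
    (hNA : NegativelyAssociated P ξ) (hξ : ∀ a, IsAEBounded P (ξ a)) {a : ι} {s : Finset ι}
    (ha : a ∉ s) {f : ℝ → ℝ} {L : ℝ} (hf : ∀ x y, |f x - f y| ≤ L * |x - y|)
    {ψ : (s → ℝ) → ℝ} {c : ℝ} (hψ : ∀ x y, |ψ x - ψ y| ≤ c * ∑ b, |x b - y b|) :
    |cov[fun ω => f (ξ a ω), fun ω => ψ fun b => ξ b ω; P]|
      ≤ -(L * c * ∑ b ∈ s, cov[ξ a, ξ b; P]) := by
  have hfc : Continuous f := (LipschitzWith.of_dist_le' hf).continuous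
  have hψc : Continuous ψ := continuous_of_abs_sub_le hψ
  have mX : MemLp (fun ω => ξ a ω) 2 P := (hξ a).memLp
  have mf : MemLp (fun ω => f (ξ a ω)) 2 P := ((hξ a).comp hfc).memLp
  have mY : MemLp (fun ω => ∑ b : s, ξ b ω) 2 P := memLp_finsetSum _ fun b _ => (hξ b).memLp
  have mψ : MemLp (fun ω => ψ fun b => ξ b ω) 2 P :=
    (IsAEBounded.comp_continuous (X := fun ω (b : s) => ξ b ω) (fun b => hξ b) hψc).memLp
  have key (σ τ : ℝ) (hσ : |σ| = 1) (hτ : |τ| = 1) :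
      L * c * cov[fun ω => ξ a ω, fun ω => ∑ b : s, ξ b ω; P]
        + L * τ * cov[fun ω => ξ a ω, fun ω => ψ fun b => ξ b ω; P]
        + σ * c * cov[fun ω => f (ξ a ω), fun ω => ∑ b : s, ξ b ω; P]
        + σ * τ * cov[fun ω => f (ξ a ω), fun ω => ψ fun b => ξ b ω; P] ≤ 0 := by
    have m1 := (mX.const_mul L).add (mf.const_mul σ)
    have m2 := (mY.const_mul c).add (mψ.const_mul τ)
    have h := hNA {a} s (by simpa using ha)
      (fun y => L * y ⟨a, by simp⟩ + σ * f (y ⟨a, by simp⟩))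
      (fun y => c * ∑ b, y b + τ * ψ y) (fun x y hxy => ?_) (fun x y hxy => ?_)
      (Continuous.measurable (by fun_prop)) (Continuous.measurable (by fun_prop)) m1 m2
    · have e : cov[fun ω => L * ξ a ω + σ * f (ξ a ω),
          fun ω => c * ∑ b : s, ξ b ω + τ * ψ fun b => ξ b ω; P] ≤ 0 := h
      rw [show (fun ω => L * ξ a ω + σ * f (ξ a ω))
          = (fun ω => L * ξ a ω) + fun ω => σ * f (ξ a ω) from rfl,
        show (fun ω => c * ∑ b : s, ξ b ω + τ * ψ fun b => ξ b ω)
          = (fun ω => c * ∑ b : s, ξ b ω) + fun ω => τ * ψ fun b => ξ b ω from rfl,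
        covariance_add_left (mX.const_mul L) (mf.const_mul σ) m2,
        covariance_add_right (mX.const_mul L) (mY.const_mul c) (mψ.const_mul τ),
        covariance_add_right (mf.const_mul σ) (mY.const_mul c) (mψ.const_mul τ)] at e
      simp only [covariance_const_mul_left, covariance_const_mul_right] at e
      linarith
    · have h1 := hxy ⟨a, by simp⟩
      set u := x ⟨a, by simp⟩
      set v := y ⟨a, by simp⟩
      have h2 : |σ * (f u - f v)| ≤ L * (v - u) := by
        rw [abs_mul, hσ, one_mul]
        exact (hf u v).trans_eq (by rw [abs_sub_comm, abs_of_nonneg (sub_nonneg.2 h1)])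
      have := (abs_le.1 h2).2
      change L * u + σ * f u ≤ L * v + σ * f v
      linarith
    · have h2 : |τ * (ψ x - ψ y)| ≤ c * ∑ b, (y b - x b) := by
        rw [abs_mul, hτ, one_mul]
        refine (hψ x y).trans_eq ?_
        congr 1
        exact Finset.sum_congr rfl fun b _ => by
          rw [abs_sub_comm, abs_of_nonneg (sub_nonneg.2 (hxy b))]
      have := (abs_le.1 h2).2
      rw [Finset.sum_sub_distrib] at this
      change c * ∑ b, x b + τ * ψ x ≤ c * ∑ b, y b + τ * ψ y
      linarith
  have hsum : cov[fun ω => ξ a ω, fun ω => ∑ b : s, ξ b ω; P] = ∑ b ∈ s, cov[ξ a, ξ b; P] := by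
    rw [covariance_fun_sum_right (fun b : s => (hξ b).memLp) mX]
    exact Finset.sum_coe_sort s fun b => cov[ξ a, ξ b; P]
  rw [hsum] at key
  have k1 := key 1 1 (by simp) (by simp)
  have k2 := key (-1) (-1) (by simp) (by simp)
  have k3 := key 1 (-1) (by simp) (by simp)
  have k4 := key (-1) 1 (by simp) (by simp)
  rw [abs_le]
  constructor <;> linarith

theorem NegativelyAssociated.cov_nonpos {ι : Type*} {ξ : ι → Ω → ℝ}
    (hNA : NegativelyAssociated P ξ) (hξ : ∀ a, IsAEBounded P (ξ a)) {a b : ι} (hab : a ≠ b) :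
    cov[ξ a, ξ b; P] ≤ 0 :=
  hNA {a} {b} (by simpa using hab) (fun y => y ⟨a, by simp⟩) (fun y => y ⟨b, by simp⟩)
    (fun _ _ h => h _) (fun _ _ h => h _) (measurable_pi_apply _) (measurable_pi_apply _)
    (hξ a).memLp (hξ b).memLp

end Covariance

/-! ### Leaving one variable out of the column sums -/

section ColSum

variable {Ω : Type*} {m : ℕ} {ξ : Fin m × Fin p → Ω → ℝ}

/-- The vector of column sums with the variable `ξ a` left out. -/
def colSumErase (ξ : Fin m × Fin p → Ω → ℝ) (a : Fin m × Fin p) (ω : Ω) : Fin p → ℝ :=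
  fun l => ∑ b ∈ Finset.univ.erase a, if b.2 = l then ξ b ω else 0

theorem colSum_eq_add_single (a : Fin m × Fin p) (ω : Ω) :
    (fun l => colSum ξ l ω) = colSumErase ξ a ω + Pi.single a.2 (ξ a ω) := by
  funext l
  have h := Finset.sum_erase_add Finset.univ (fun b => if b.2 = l then ξ b ω else 0)
    (Finset.mem_univ a)
  have h2 : ∑ b : Fin m × Fin p, (if b.2 = l then ξ b ω else 0) = colSum ξ l ω := by
    rw [Fintype.sum_prod_type, colSum]
    exact Finset.sum_congr rfl fun i _ => by simp
  rw [← h2, ← h, Pi.add_apply, colSumErase, Pi.single_apply]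
  simp only [eq_comm]

variable [MeasurableSpace Ω] {P : Measure Ω}

theorem isAEBounded_colSum (hξ : ∀ a, IsAEBounded P (ξ a)) (l : Fin p) :
    IsAEBounded P (colSum ξ l) :=
  IsAEBounded.comp_continuous (X := fun ω a => ξ a ω) (g := fun v => ∑ i, v (i, l)) hξ
    (by fun_prop)

theorem isAEBounded_colSumErase (hξ : ∀ a, IsAEBounded P (ξ a)) (a : Fin m × Fin p)
    (l : Fin p) : IsAEBounded P fun ω => colSumErase ξ a ω l :=
  IsAEBounded.comp_continuous (X := fun ω b => ξ b ω)
    (g := fun v => ∑ b ∈ Finset.univ.erase a, if b.2 = l then v b else 0) hξ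
    (continuous_finsetSum _ fun b _ => by split_ifs <;> fun_prop)

variable [IsProbabilityMeasure P]

theorem NegativelyAssociated.abs_cov_colSumErase_le (hNA : NegativelyAssociated P ξ)
    (hξ : ∀ a, IsAEBounded P (ξ a)) (a : Fin m × Fin p) {f : ℝ → ℝ} {L : ℝ}
    (hf : ∀ x y, |f x - f y| ≤ L * |x - y|) {g : (Fin p → ℝ) → ℝ} {c : ℝ} (hc : 0 ≤ c)
    (hg : ∀ x y, |g x - g y| ≤ c * ∑ l, |x l - y l|) :
    |cov[fun ω => f (ξ a ω), fun ω => g (colSumErase ξ a ω); P]|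
      ≤ -(L * c * ∑ b ∈ Finset.univ.erase a, cov[ξ a, ξ b; P]) := by
  have h := hNA.abs_cov_le hξ (Finset.notMem_erase a Finset.univ) hf (c := c)
    (ψ := fun y => g fun l => ∑ b, if b.1.2 = l then y b else 0) (fun x y => ?_)
  · refine le_trans (le_of_eq ?_) h
    congr 2
    funext ω
    congr 1
    funext l
    exact (Finset.sum_coe_sort (Finset.univ.erase a) fun b => if b.2 = l then ξ b ω else 0).symm
  · refine (hg _ _).trans (mul_le_mul_of_nonneg_left ?_ hc)
    calc ∑ l, |(∑ b : (Finset.univ.erase a : Finset (Fin m × Fin p)), if b.1.2 = l then x b else 0)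
            - ∑ b, if b.1.2 = l then y b else 0|
        ≤ ∑ l, ∑ b : (Finset.univ.erase a : Finset (Fin m × Fin p)),
            (if b.1.2 = l then |x b - y b| else 0) := by
          refine Finset.sum_le_sum fun l _ => ?_
          rw [← Finset.sum_sub_distrib]
          refine (Finset.abs_sum_le_sum_abs _ _).trans (Finset.sum_le_sum fun b _ => ?_)
          split_ifs <;> simp
      _ = ∑ b, |x b - y b| := by
          rw [Finset.sum_comm]
          exact Finset.sum_congr rfl fun b _ => by simp

/-! ### The Stein discrepancy of the column sums -/

/-- First order expansion with an `ℓ¹`-Lipschitz derivative. The factor `1 / 2` of Taylor's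
formula is not needed. -/
theorem abs_sub_sub_mul_le {j : Fin p} {g g' : (Fin p → ℝ) → ℝ} (hg : HasPartial j g g') {c : ℝ}
    (hc : 0 ≤ c) (hg' : ∀ x y, |g' x - g' y| ≤ c * ∑ l, |x l - y l|) (x : Fin p → ℝ) (t : ℝ) :
    |g (x + Pi.single j t) - g x - t * g' x| ≤ c * t ^ 2 := by
  have hd (u : ℝ) : HasDerivAt (fun u : ℝ => g (x + Pi.single j u) - u * g' x)
      (g' (x + Pi.single j u) - g' x) u := by
    simpa using (hg.hasDerivAt x u).fun_sub ((hasDerivAt_id' u).mul_const (g' x))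
  have := (convex_uIcc 0 t).norm_image_sub_le_of_norm_hasDerivWithin_le (C := c * |t|)
    (fun u _ => (hd u).hasDerivWithinAt) (fun u hu => ?_) Set.left_mem_uIcc Set.right_mem_uIcc
  · have e : c * |t| * |t| = c * t ^ 2 := by rw [mul_assoc, abs_mul_abs_self, sq]
    simp only [Pi.single_zero, add_zero, zero_mul, sub_zero, Real.norm_eq_abs, e] at this
    rwa [sub_right_comm]
  · refine (hg' _ _).trans (mul_le_mul_of_nonneg_left ?_ hc)
    have : ∑ l, |(x + Pi.single j u : Fin p → ℝ) l - x l| = |u| := by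
      simp only [Pi.add_apply, add_sub_cancel_left]
      rw [Finset.sum_eq_single j (fun l _ hl => by simp [hl]) (by simp)]
      simp
    rw [this]
    simpa using Set.abs_sub_left_of_mem_uIcc hu

theorem abs_clamp_sq_sub_le {B : ℝ} (hB : 0 ≤ B) (x y : ℝ) :
    |(max (-B) (min B x)) ^ 2 - (max (-B) (min B y)) ^ 2| ≤ 2 * B * |x - y| := by
  have hx : |max (-B) (min B x)| ≤ B := abs_le.2 ⟨le_max_left _ _, by simp [hB]⟩
  have hy : |max (-B) (min B y)| ≤ B := abs_le.2 ⟨le_max_left _ _, by simp [hB]⟩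
  have hxy : |max (-B) (min B x) - max (-B) (min B y)| ≤ |x - y| := 
    (abs_max_sub_max_le_max _ _ _ _).trans (max_le (by simp)
      ((abs_min_sub_min_le_max _ _ _ _).trans (max_le (by simp) le_rfl)))
  rw [sq_sub_sq, abs_mul]
  exact mul_le_mul ((abs_add_le _ _).trans (by linarith)) hxy (abs_nonneg _) (by linarith)

/-- The Stein identity for a single summand: leaving `ξ a` out of the sums, `E ξ_a g(S)` is
`E ξ_a² · E g'(S)` up to covariances controlled by negative association and a remainder. -/
theorem NegativelyAssociated.abs_integral_mul_sub_le (hNA : NegativelyAssociated P ξ)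
    (hξ : ∀ a, AEMeasurable (ξ a) P) (hmean : ∀ a, ∫ ω, ξ a ω ∂P = 0) {B : ℝ} (hB : 0 ≤ B)
    (hbound : ∀ a, ∀ᵐ ω ∂P, |ξ a ω| ≤ B) (a : Fin m × Fin p) {g g' : (Fin p → ℝ) → ℝ}
    (hgg' : HasPartial a.2 g g') {c c' : ℝ} (hc : 0 ≤ c) (hc' : 0 ≤ c')
    (hg : ∀ x y, |g x - g y| ≤ c * ∑ l, |x l - y l|)
    (hg' : ∀ x y, |g' x - g' y| ≤ c' * ∑ l, |x l - y l|) :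
    |∫ ω, ξ a ω * g (fun l => colSum ξ l ω) ∂P
        - (∫ ω, ξ a ω ^ 2 ∂P) * ∫ ω, g' (fun l => colSum ξ l ω) ∂P|
      ≤ 2 * c' * B * ∫ ω, ξ a ω ^ 2 ∂P
        - (c + 2 * B * c') * ∑ b ∈ Finset.univ.erase a, cov[ξ a, ξ b; P] := by
  have bξ (a) : IsAEBounded P (ξ a) := ⟨hξ a, B, hbound a⟩
  have cg := continuous_of_abs_sub_le hg
  have cg' := continuous_of_abs_sub_le hg'
  have bq : IsAEBounded P fun ω => ξ a ω ^ 2 := (bξ a).comp (continuous_pow 2)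
  have bgS : IsAEBounded P fun ω => g fun l => colSum ξ l ω :=
    IsAEBounded.comp_continuous (fun l => isAEBounded_colSum bξ l) cg
  have bgS' : IsAEBounded P fun ω => g' fun l => colSum ξ l ω :=
    IsAEBounded.comp_continuous (fun l => isAEBounded_colSum bξ l) cg'
  have bgT : IsAEBounded P fun ω => g (colSumErase ξ a ω) :=
    IsAEBounded.comp_continuous (fun l => isAEBounded_colSumErase bξ a l) cg
  have bgT' : IsAEBounded P fun ω => g' (colSumErase ξ a ω) :=
    IsAEBounded.comp_continuous (fun l => isAEBounded_colSumErase bξ a l) cg'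
  set q := ∫ ω, ξ a ω ^ 2 ∂P
  set K := ∑ b ∈ Finset.univ.erase a, cov[ξ a, ξ b; P]
  have hq : 0 ≤ q := integral_nonneg fun ω => sq_nonneg _
  have k1 : |∫ ω, ξ a ω * g (colSumErase ξ a ω) ∂P| ≤ -(c * K) := by
    have h := hNA.abs_cov_colSumErase_le bξ a (f := fun x => x) (L := 1) (by simp) hc hg
    rw [covariance_eq_sub (bξ a).memLp bgT.memLp, hmean a, zero_mul, sub_zero, one_mul] at h
    exact h
  have k2 : |∫ ω, ξ a ω ^ 2 * g' (colSumErase ξ a ω) ∂P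
      - q * ∫ ω, g' (colSumErase ξ a ω) ∂P| ≤ -(2 * B * c' * K) := by
    -- the square is only Lipschitz on `[-B, B]`, so it is clamped, which changes nothing a.s.
    have h := hNA.abs_cov_colSumErase_le bξ a (f := fun x => (max (-B) (min B x)) ^ 2)
      (abs_clamp_sq_sub_le hB) hc' hg'
    have hae : (fun ω => (max (-B) (min B (ξ a ω))) ^ 2) =ᵐ[P] fun ω => ξ a ω ^ 2 := by
      filter_upwards [hbound a] with ω hω
      rw [abs_le] at hω
      rw [min_eq_right hω.2, max_eq_right hω.1]
    rw [covariance_eq_sub (MemLp.ae_eq hae.symm bq.memLp) bgT'.memLp, integral_congr_ae hae,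
      integral_congr_ae (hae.mul (Filter.EventuallyEq.refl _ _))] at h
    exact h
  have k3 : |∫ ω, ξ a ω * (g (fun l => colSum ξ l ω) - g (colSumErase ξ a ω)
      - ξ a ω * g' (colSumErase ξ a ω)) ∂P| ≤ c' * B * q := by
    have hb : ∀ᵐ ω ∂P, ‖ξ a ω * (g (fun l => colSum ξ l ω) - g (colSumErase ξ a ω)
        - ξ a ω * g' (colSumErase ξ a ω))‖ ≤ c' * B * ξ a ω ^ 2 := by
      filter_upwards [hbound a] with ω hω
      rw [norm_mul, colSum_eq_add_single a ω]
      calc ‖ξ a ω‖ * ‖g (colSumErase ξ a ω + Pi.single a.2 (ξ a ω)) - g (colSumErase ξ a ω)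
            - ξ a ω * g' (colSumErase ξ a ω)‖ ≤ B * (c' * ξ a ω ^ 2) :=
            mul_le_mul hω (abs_sub_sub_mul_le hgg' hc' hg' _ _) (norm_nonneg _) hB
        _ = _ := by ring
    rw [← integral_const_mul]
    exact norm_integral_le_of_norm_le (bq.integrable.const_mul _) hb
  have k4 : |∫ ω, g' (colSumErase ξ a ω) ∂P - ∫ ω, g' (fun l => colSum ξ l ω) ∂P| ≤ c' * B := by
    rw [← integral_sub bgT'.integrable bgS'.integrable]
    have : ∀ᵐ ω ∂P, ‖g' (colSumErase ξ a ω) - g' (fun l => colSum ξ l ω)‖ ≤ c' * B := by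
      filter_upwards [hbound a] with ω hω
      refine (hg' _ _).trans (mul_le_mul_of_nonneg_left ?_ hc')
      simp_rw [fun l => congrFun (colSum_eq_add_single (ξ := ξ) a ω) l]
      refine le_trans (le_of_eq ?_) hω
      simp only [Pi.add_apply, sub_add_cancel_left, abs_neg]
      rw [Finset.sum_eq_single a.2 (fun l _ hl => by simp [hl]) (by simp)]
      simp
    simpa using norm_integral_le_of_norm_le_const this
  have split : ∫ ω, ξ a ω * (g (fun l => colSum ξ l ω) - g (colSumErase ξ a ω)
      - ξ a ω * g' (colSumErase ξ a ω)) ∂P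
      = ∫ ω, ξ a ω * g (fun l => colSum ξ l ω) ∂P - ∫ ω, ξ a ω * g (colSumErase ξ a ω) ∂P
        - ∫ ω, ξ a ω ^ 2 * g' (colSumErase ξ a ω) ∂P := by
    have hi : Integrable (fun ω => ξ a ω * g (fun l => colSum ξ l ω)
        - ξ a ω * g (colSumErase ξ a ω)) P :=
      ((bξ a).mul bgS).integrable.sub ((bξ a).mul bgT).integrable
    rw [← integral_sub ((bξ a).mul bgS).integrable ((bξ a).mul bgT).integrable,
      ← integral_sub hi (bq.mul bgT').integrable]
    congr 1 with ω
    ring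
  have k5 : |q * (∫ ω, g' (colSumErase ξ a ω) ∂P - ∫ ω, g' (fun l => colSum ξ l ω) ∂P)|
      ≤ q * (c' * B) := by
    rw [abs_mul, abs_of_nonneg hq]
    exact mul_le_mul_of_nonneg_left k4 hq
  rw [split] at k3
  rw [abs_le] at *
  constructor <;> nlinarith [k1.1, k1.2, k2.1, k2.2, k3.1, k3.2, k5.1, k5.2]

/-- `∑ j, x j * ∂_j G x - ∑ j l, V j l * ∂_l ∂_j G x`, the Stein operator of the centred normal law
with covariance matrix `V`. -/
noncomputable def covSteinOp (V : Matrix (Fin p) (Fin p) ℝ) (G : (Fin p → ℝ) → ℝ)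
    (x : Fin p → ℝ) : ℝ :=
  ∑ j, x j * pd j G x - ∑ j, ∑ l, V j l * pd l (pd j G) x

theorem covMatrix_colSum_apply (hξ : ∀ a, IsAEBounded P (ξ a)) (j l : Fin p) :
    covMatrix P (colSum ξ) j l = ∑ i, ∑ k, cov[ξ (i, j), ξ (k, l); P] := by
  have h := covariance_fun_sum_fun_sum (X := fun i => ξ (i, j)) (Y := fun k => ξ (k, l)) (μ := P)
    (fun i => (hξ _).memLp) (fun k => (hξ _).memLp)
  exact h

theorem sum_sum_eq_sum_diag_add {κ : Type*} [Fintype κ] [DecidableEq κ] (f : κ → κ → ℝ) :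
    ∑ i, ∑ k, f i k = ∑ i, f i i + ∑ i, ∑ k with i ≠ k, f i k := by
  rw [← Finset.sum_add_distrib]
  refine Finset.sum_congr rfl fun i _ => ?_
  rw [← Finset.sum_filter_add_sum_filter_not Finset.univ (fun k => i = k)]
  simp [Finset.filter_eq]

theorem sum_sum_erase_cov (hξ : ∀ a, IsAEBounded P (ξ a)) :
    ∑ a, ∑ b ∈ Finset.univ.erase a, cov[ξ a, ξ b; P]
      = ∑ j, ∑ i, ∑ k with i ≠ k, cov[ξ (i, j), ξ (k, j); P]
        + ∑ j, ∑ l with j ≠ l, covMatrix P (colSum ξ) j l := by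
  have h1 := sum_sum_eq_sum_diag_add fun j l => covMatrix P (colSum ξ) j l
  have h2 : ∑ a, ∑ b, cov[ξ a, ξ b; P] = ∑ j, ∑ l, covMatrix P (colSum ξ) j l := by
    simp_rw [covMatrix_colSum_apply hξ, Fintype.sum_prod_type_right]
    refine Finset.sum_congr rfl fun j _ => ?_
    rw [Finset.sum_comm]
  have h3 (a : Fin m × Fin p) := Finset.add_sum_erase Finset.univ (fun b => cov[ξ a, ξ b; P])
    (Finset.mem_univ a)
  have h4 (j : Fin p) : covMatrix P (colSum ξ) j j = ∑ i, cov[ξ (i, j), ξ (i, j); P]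
      + ∑ i, ∑ k with i ≠ k, cov[ξ (i, j), ξ (k, j); P] := by
    rw [covMatrix_colSum_apply hξ, sum_sum_eq_sum_diag_add]
  simp_rw [h4, Finset.sum_add_distrib] at h1
  simp_rw [← h3, Finset.sum_add_distrib, Fintype.sum_prod_type_right] at h2
  rw [h1] at h2
  rw [Fintype.sum_prod_type_right]
  linarith

theorem NegativelyAssociated.abs_integral_covSteinOp_le (hNA : NegativelyAssociated P ξ)
    (hξ : ∀ a, AEMeasurable (ξ a) P) (hmean : ∀ a, ∫ ω, ξ a ω ∂P = 0) {B : ℝ} (hB : 0 ≤ B)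
    (hbound : ∀ a, ∀ᵐ ω ∂P, |ξ a ω| ≤ B) {G : (Fin p → ℝ) → ℝ} (hG : ContDiff ℝ (⊤ : ℕ∞) G)
    {c₂ c₃ : ℝ} (h₂ : ∀ i j x, |pd i (pd j G) x| ≤ c₂)
    (h₃ : ∀ i j k x, |pd i (pd j (pd k G)) x| ≤ c₃) (hc₂ : 0 ≤ c₂) (hc₃ : 0 ≤ c₃) :
    |∫ ω, covSteinOp (covMatrix P (colSum ξ)) G (fun l => colSum ξ l ω) ∂P|
      ≤ 2 * c₃ * B * ∑ j, covMatrix P (colSum ξ) j j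
        - (4 * c₃ * B + 2 * c₂) * ∑ j, ∑ i, ∑ k with i ≠ k, cov[ξ (i, j), ξ (k, j); P]
        - (2 * c₃ * B + 2 * c₂) * ∑ j, ∑ l with j ≠ l, covMatrix P (colSum ξ) j l := by
  have bξ (a) : IsAEBounded P (ξ a) := ⟨hξ a, B, hbound a⟩
  set V := covMatrix P (colSum ξ)
  have d1 (j : Fin p) := contDiff_pd hG j
  have d2 (j l : Fin p) := contDiff_pd (d1 j) l
  have b1 (j : Fin p) : IsAEBounded P fun ω => pd j G fun l => colSum ξ l ω :=
    IsAEBounded.comp_continuous (fun l => isAEBounded_colSum bξ l) (d1 j).continuous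
  have b2 (j l : Fin p) : IsAEBounded P fun ω => pd l (pd j G) fun l => colSum ξ l ω :=
    IsAEBounded.comp_continuous (fun l => isAEBounded_colSum bξ l) (d2 j l).continuous
  set e : Fin p → Fin p → ℝ := fun j l => ∫ ω, pd l (pd j G) (fun l => colSum ξ l ω) ∂P
  have be (j l : Fin p) : |e j l| ≤ c₂ := by
    have := norm_integral_le_of_norm_le_const (μ := P) (C := c₂)
      (f := fun ω => pd l (pd j G) fun l => colSum ξ l ω)
      (Filter.Eventually.of_forall fun ω => h₂ l j _)
    simpa using this
  set q : Fin m × Fin p → ℝ := fun a => ∫ ω, ξ a ω ^ 2 ∂P with hq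
  have hqc (a) : cov[ξ a, ξ a; P] = q a := by
    rw [covariance_eq_sub (bξ a).memLp (bξ a).memLp, hmean a]
    simp [hq, sq]
  have hVc (j l : Fin p) : V j l = ∑ i, ∑ k, cov[ξ (i, j), ξ (k, l); P] :=
    covMatrix_colSum_apply bξ j l
  have hV (j : Fin p) : V j j = ∑ i, q (i, j)
      + ∑ i, ∑ k with i ≠ k, cov[ξ (i, j), ξ (k, j); P] := by
    rw [hVc, sum_sum_eq_sum_diag_add]
    simp_rw [hqc]
  have hN (j : Fin p) : ∑ i, ∑ k with i ≠ k, cov[ξ (i, j), ξ (k, j); P] ≤ 0 :=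
    Finset.sum_nonpos fun i _ => Finset.sum_nonpos fun k hk =>
      hNA.cov_nonpos bξ (by simpa using (Finset.mem_filter.1 hk).2)
  have hO (j l : Fin p) (hjl : j ≠ l) : V j l ≤ 0 := by
    rw [hVc]
    exact Finset.sum_nonpos fun i _ => Finset.sum_nonpos fun k _ =>
      hNA.cov_nonpos bξ (by simp [hjl])
  -- each summand contributes `r a` besides the main term
  set r : Fin m × Fin p → ℝ := fun a =>
    ∫ ω, ξ a ω * pd a.2 G (fun l => colSum ξ l ω) ∂P - q a * e a.2 a.2 with hr
  have br (a) : |r a| ≤ 2 * c₃ * B * q a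
      - (c₂ + 2 * B * c₃) * ∑ b ∈ Finset.univ.erase a, cov[ξ a, ξ b; P] :=
    hNA.abs_integral_mul_sub_le hξ hmean hB hbound a
      (hasPartial_pd ((d1 a.2).differentiable (by simp)) a.2) hc₂ hc₃
      (abs_sub_le_of_abs_pd_le ((d1 a.2).differentiable (by simp)) fun i x => h₂ i a.2 x)
      (abs_sub_le_of_abs_pd_le ((d2 a.2 a.2).differentiable (by simp))
        fun i x => h₃ i a.2 a.2 x)
  have main : ∫ ω, covSteinOp V G (fun l => colSum ξ l ω) ∂P
      = ∑ a, r a - ∑ j, (∑ i, ∑ k with i ≠ k, cov[ξ (i, j), ξ (k, j); P]) * e j j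
        - ∑ j, ∑ l with j ≠ l, V j l * e j l := by
    have s1 : ∫ ω, covSteinOp V G (fun l => colSum ξ l ω) ∂P
        = ∑ a : Fin m × Fin p, ∫ ω, ξ a ω * pd a.2 G (fun l => colSum ξ l ω) ∂P
          - ∑ j, ∑ l, V j l * e j l := by
      simp only [covSteinOp]
      rw [integral_sub, integral_finsetSum, integral_finsetSum]
      · congr 1
        · rw [Fintype.sum_prod_type_right]
          refine Finset.sum_congr rfl fun j _ => ?_
          rw [← integral_finsetSum _ fun i _ => ((bξ (i, j)).mul (b1 j)).integrable]
          congr 1 with ω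
          rw [← Finset.sum_mul, colSum]
        · refine Finset.sum_congr rfl fun j _ => ?_
          rw [integral_finsetSum _ fun l _ => (b2 j l).integrable.const_mul _]
          exact Finset.sum_congr rfl fun l _ => integral_const_mul _ _
      · exact fun j _ => integrable_finsetSum _ fun l _ => (b2 j l).integrable.const_mul _
      · exact fun j _ => ((isAEBounded_colSum bξ j).mul (b1 j)).integrable
      · exact integrable_finsetSum _ fun j _ =>
          ((isAEBounded_colSum bξ j).mul (b1 j)).integrable
      · exact integrable_finsetSum _ fun j _ => integrable_finsetSum _ fun l _ =>
          (b2 j l).integrable.const_mul _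
    have s2 : ∑ j, V j j * e j j = ∑ a : Fin m × Fin p, q a * e a.2 a.2
        + ∑ j, (∑ i, ∑ k with i ≠ k, cov[ξ (i, j), ξ (k, j); P]) * e j j := by
      simp_rw [hV, add_mul, Finset.sum_add_distrib, Fintype.sum_prod_type_right, Finset.sum_mul]
    rw [s1, sum_sum_eq_sum_diag_add fun j l => V j l * e j l, s2, hr, Finset.sum_sub_distrib]
    ring
  have t1 : |∑ a, r a| ≤ 2 * c₃ * B * ∑ a, q a - (c₂ + 2 * B * c₃)
      * ∑ a, ∑ b ∈ Finset.univ.erase a, cov[ξ a, ξ b; P] := by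
    refine (Finset.abs_sum_le_sum_abs _ _).trans ((Finset.sum_le_sum fun a _ => br a).trans_eq ?_)
    rw [Finset.sum_sub_distrib, Finset.mul_sum, Finset.mul_sum]
  have t2 : |∑ j, (∑ i, ∑ k with i ≠ k, cov[ξ (i, j), ξ (k, j); P]) * e j j|
      ≤ -(c₂ * ∑ j, ∑ i, ∑ k with i ≠ k, cov[ξ (i, j), ξ (k, j); P]) := by
    rw [Finset.mul_sum, ← Finset.sum_neg_distrib]
    refine (Finset.abs_sum_le_sum_abs _ _).trans (Finset.sum_le_sum fun j _ => ?_)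
    rw [abs_mul, abs_of_nonpos (hN j)]
    nlinarith [hN j, be j j]
  have t3 : |∑ j, ∑ l with j ≠ l, V j l * e j l| ≤ -(c₂ * ∑ j, ∑ l with j ≠ l, V j l) := by
    simp_rw [Finset.mul_sum]
    simp_rw [← Finset.sum_neg_distrib]
    refine (Finset.abs_sum_le_sum_abs _ _).trans (Finset.sum_le_sum fun j _ =>
      (Finset.abs_sum_le_sum_abs _ _).trans (Finset.sum_le_sum fun l hl => ?_))
    have := hO j l (Finset.mem_filter.1 hl).2
    rw [abs_mul, abs_of_nonpos this]
    nlinarith [be j l]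
  have hqs : ∑ j, V j j = ∑ a, q a + ∑ j, ∑ i, ∑ k with i ≠ k, cov[ξ (i, j), ξ (k, j); P] := by
    simp_rw [hV, Finset.sum_add_distrib, Fintype.sum_prod_type_right]
  have hsum : ∑ a, ∑ b ∈ Finset.univ.erase a, cov[ξ a, ξ b; P]
      = ∑ j, ∑ i, ∑ k with i ≠ k, cov[ξ (i, j), ξ (k, j); P] + ∑ j, ∑ l with j ≠ l, V j l :=
    sum_sum_erase_cov bξ
  rw [hsum] at t1
  rw [main, hqs]
  rw [abs_le] at *
  constructor <;> nlinarith [t1.1, t1.2, t2.1, t2.2, t3.1, t3.2]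

end ColSum

/-! ### Linear changes of variables and the inverse square root -/

theorem pd_sum_mul {κ : Type*} [Fintype κ] (c : κ → ℝ) {f : κ → (Fin p → ℝ) → ℝ}
    (hf : ∀ k, Differentiable ℝ (f k)) (i : Fin p) :
    pd i (fun x => ∑ k, c k * f k x) = fun x => ∑ k, c k * pd i (f k) x := by
  funext x
  have h := HasFDerivAt.fun_sum (u := Finset.univ) (A := fun k x => c k * f k x)
    fun k _ => ((hf k x).hasFDerivAt.const_mul (c k))
  simp only [pd]
  rw [h.fderiv]
  simp

theorem contDiff_comp_mulVec (N : Matrix (Fin p) (Fin p) ℝ) {F : (Fin p → ℝ) → ℝ}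
    (hF : ContDiff ℝ (⊤ : ℕ∞) F) : ContDiff ℝ (⊤ : ℕ∞) fun x => F (N.mulVec x) :=
  hF.comp (Matrix.mulVecLin N).toContinuousLinearMap.contDiff

theorem pd_comp_mulVec (N : Matrix (Fin p) (Fin p) ℝ) {F : (Fin p → ℝ) → ℝ}
    (hF : Differentiable ℝ F) (j : Fin p) :
    pd j (fun x => F (N.mulVec x)) = fun x => ∑ a, N a j * pd a F (N.mulVec x) := by
  funext x
  have h := (hF (N.mulVec x)).hasFDerivAt.comp x
    (Matrix.mulVecLin N).toContinuousLinearMap.hasFDerivAt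
  have e : N.mulVec (Pi.single j 1) = ∑ a, N a j • (Pi.single a 1 : Fin p → ℝ) := by
    ext b; simp [Finset.sum_apply, Pi.single_apply]
  simp only [pd]
  rw [show (fun x => F (N.mulVec x)) = F ∘ N.mulVec from rfl, h.fderiv]
  simp only [ContinuousLinearMap.comp_apply, LinearMap.coe_toContinuousLinearMap',
    Matrix.mulVecLin_apply]
  rw [e, map_sum]
  simp

theorem pd_pd_comp_mulVec (N : Matrix (Fin p) (Fin p) ℝ) {F : (Fin p → ℝ) → ℝ}
    (hF : ContDiff ℝ (⊤ : ℕ∞) F) (l j : Fin p) :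
    pd l (pd j fun x => F (N.mulVec x))
      = fun x => ∑ a, N a j * ∑ b, N b l * pd b (pd a F) (N.mulVec x) := by
  have d (a : Fin p) := contDiff_pd hF a
  rw [pd_comp_mulVec N (hF.differentiable (by simp)), pd_sum_mul (fun a => N a j)
    fun a => (contDiff_comp_mulVec N (d a)).differentiable (by simp)]
  simp_rw [fun a => pd_comp_mulVec N ((d a).differentiable (by simp)) l]

theorem pd_pd_pd_comp_mulVec (N : Matrix (Fin p) (Fin p) ℝ) {F : (Fin p → ℝ) → ℝ}
    (hF : ContDiff ℝ (⊤ : ℕ∞) F) (k l j : Fin p) :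
    pd k (pd l (pd j fun x => F (N.mulVec x)))
      = fun x => ∑ a, N a j * ∑ b, N b l * ∑ c, N c k * pd c (pd b (pd a F)) (N.mulVec x) := by
  have d (a : Fin p) := contDiff_pd hF a
  rw [pd_comp_mulVec N (hF.differentiable (by simp)), pd_sum_mul (fun a => N a j)
    fun a => (contDiff_comp_mulVec N (d a)).differentiable (by simp),
    pd_sum_mul (fun a => N a j)
    fun a => (contDiff_pd (contDiff_comp_mulVec N (d a)) l).differentiable (by simp)]
  simp_rw [fun a => pd_pd_comp_mulVec N (d a) k l]

theorem abs_sum_mul_le {c f : Fin p → ℝ} {K C : ℝ} (hc : ∀ a, |c a| ≤ K) (hf : ∀ a, |f a| ≤ C)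
    (hK : 0 ≤ K) : |∑ a, c a * f a| ≤ p * K * C := by
  calc |∑ a, c a * f a| ≤ ∑ _a : Fin p, K * C :=
        (Finset.abs_sum_le_sum_abs _ _).trans (Finset.sum_le_sum fun a _ => by
          rw [abs_mul]
          exact mul_le_mul (hc a) (hf a) (abs_nonneg _) hK)
    _ = p * K * C := by simp [mul_assoc]

theorem abs_le_entrySup (N : Matrix (Fin p) (Fin p) ℝ) (i j : Fin p) : |N i j| ≤ entrySup N :=
  le_ciSup (f := fun q : Fin p × Fin p => |N q.1 q.2|) (Set.finite_range _).bddAbove (i, j)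

theorem entrySup_nonneg (N : Matrix (Fin p) (Fin p) ℝ) : 0 ≤ entrySup N :=
  Real.iSup_nonneg fun _ => abs_nonneg _

/-- Whitening turns the Stein operator with covariance `V` into the standard one. -/
theorem steinOp_mulVec {N V : Matrix (Fin p) (Fin p) ℝ} (hN : N * V * N.transpose = 1)
    {F : (Fin p → ℝ) → ℝ} (hF : ContDiff ℝ (⊤ : ℕ∞) F) (x : Fin p → ℝ) :
    steinOp F (N.mulVec x) = covSteinOp V (fun x => F (N.mulVec x)) x := by
  have hδ (a b : Fin p) : ∑ j, ∑ l, N a j * V j l * N b l = if a = b then 1 else 0 := by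
    have := congrFun (congrFun hN a) b
    rw [Matrix.one_apply, Matrix.mul_apply] at this
    rw [← this, Finset.sum_comm]
    simp [Matrix.mul_apply, Finset.sum_mul]
  unfold steinOp covSteinOp
  congr 1
  · simp_rw [pd_comp_mulVec N (hF.differentiable (by simp)), Matrix.mulVec, dotProduct,
      Finset.sum_mul, Finset.mul_sum]
    rw [Finset.sum_comm]
    exact Finset.sum_congr rfl fun j _ => Finset.sum_congr rfl fun a _ => by ring
  · simp_rw [pd_pd_comp_mulVec N hF]
    symm
    calc ∑ j, ∑ l, V j l * ∑ a, N a j * ∑ b, N b l * pd b (pd a F) (N.mulVec x)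
        = ∑ j, ∑ l, ∑ a, ∑ b, N a j * V j l * N b l * pd b (pd a F) (N.mulVec x) := by
          simp_rw [Finset.mul_sum]
          exact Finset.sum_congr rfl fun j _ => Finset.sum_congr rfl fun l _ =>
            Finset.sum_congr rfl fun a _ => Finset.sum_congr rfl fun b _ => by ring
      _ = ∑ a, ∑ b, (∑ j, ∑ l, N a j * V j l * N b l) * pd b (pd a F) (N.mulVec x) := by
          simp_rw [Finset.sum_mul]
          rw [Finset.sum_congr rfl fun j _ => Finset.sum_comm, Finset.sum_comm]
          refine Finset.sum_congr rfl fun a _ => ?_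
          rw [Finset.sum_congr rfl fun j _ => Finset.sum_comm, Finset.sum_comm]
      _ = ∑ a, pd a (pd a F) (N.mulVec x) := by simp [hδ]

theorem invSqrt_mul_mul_transpose {V : Matrix (Fin p) (Fin p) ℝ} (hV : V.PosDef) :
    invSqrt V * V * (invSqrt V).transpose = 1 := by
  have h1 : CFC.sqrt V * CFC.sqrt V = V :=
    CFC.sqrt_mul_sqrt_self V (Matrix.nonneg_iff_posSemidef.2 hV.posSemidef)
  have h2 : (CFC.sqrt V).transpose = CFC.sqrt V := by
    have := (Matrix.nonneg_iff_posSemidef.1 (CFC.sqrt_nonneg V)).isHermitian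
    rwa [Matrix.IsHermitian, Matrix.conjTranspose_eq_transpose_of_trivial] at this
  have h3 : IsUnit (CFC.sqrt V).det := by
    have := hV.det_pos.ne'
    rw [← h1, Matrix.det_mul] at this
    exact (left_ne_zero_of_mul this).isUnit
  rw [invSqrt, Matrix.transpose_nonsing_inv, h2]
  nth_rewrite 2 [← h1]
  rw [← mul_assoc, Matrix.nonsing_inv_mul _ h3, one_mul, Matrix.mul_nonsing_inv _ h3]

/-! ### The bound for the standardized sums -/

section Main

variable {Ω : Type*} [MeasurableSpace Ω] {P : Measure Ω} {m : ℕ}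
  {ξ : Fin m × Fin p → Ω → ℝ}

theorem standardized_colSum (hξ : ∀ a, Integrable (ξ a) P) (hmean : ∀ a, ∫ ω, ξ a ω ∂P = 0)
    (ω : Ω) : standardized P (colSum ξ) ω
      = (invSqrt (covMatrix P (colSum ξ))).mulVec fun l => colSum ξ l ω := by
  have h (j : Fin p) : ∫ ω, colSum ξ j ω ∂P = 0 := by
    simp only [colSum]
    rw [integral_finsetSum _ fun i _ => hξ (i, j)]
    exact Finset.sum_eq_zero fun i _ => hmean _
  simp only [standardized, h, sub_zero]

/-- The bound on the Stein discrepancy of the standardized sums; the factors `p² K²` and `p³ K³`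
come from the chain rule for the linear map `Σ^{-1/2}`. -/
theorem NegativelyAssociated.abs_integral_steinOp_le [IsProbabilityMeasure P]
    (hNA : NegativelyAssociated P ξ)
    (hξ : ∀ a, AEMeasurable (ξ a) P) (hmean : ∀ a, ∫ ω, ξ a ω ∂P = 0) {B : ℝ} (hB : 0 ≤ B)
    (hbound : ∀ a, ∀ᵐ ω ∂P, |ξ a ω| ≤ B) (hpos : (covMatrix P (colSum ξ)).PosDef)
    {F : (Fin p → ℝ) → ℝ} (hF : ContDiff ℝ (⊤ : ℕ∞) F)
    {c₂ c₃ : ℝ} (h₂ : ∀ i j x, |pd i (pd j F) x| ≤ c₂)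
    (h₃ : ∀ i j k x, |pd i (pd j (pd k F)) x| ≤ c₃) (hc₂ : 0 ≤ c₂) (hc₃ : 0 ≤ c₃)
    {K : ℝ} (hK : K = entrySup (invSqrt (covMatrix P (colSum ξ)))) :
    |∫ ω, steinOp F (standardized P (colSum ξ) ω) ∂P|
      ≤ -(2 * (p : ℝ) ^ 2 * K ^ 2 * (∑ j, ∑ i, ∑ k with i ≠ k, cov[ξ (i, j), ξ (k, j); P]
          + ∑ j, ∑ l with j ≠ l, covMatrix P (colSum ξ) j l)) * c₂
        + (p : ℝ) ^ 3 * B * K ^ 3 * (2 * ∑ j, covMatrix P (colSum ξ) j j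
          - 4 * ∑ j, ∑ i, ∑ k with i ≠ k, cov[ξ (i, j), ξ (k, j); P]
          - 2 * ∑ j, ∑ l with j ≠ l, covMatrix P (colSum ξ) j l) * c₃ := by
  have hK0 : 0 ≤ K := hK ▸ entrySup_nonneg _
  set N := invSqrt (covMatrix P (colSum ξ)) with hN
  have hNK (a b : Fin p) : |N a b| ≤ K := hK ▸ abs_le_entrySup N a b
  have h := hNA.abs_integral_covSteinOp_le hξ hmean hB hbound
    (contDiff_comp_mulVec N hF) (c₂ := p * K * (p * K * c₂))
    (c₃ := p * K * (p * K * (p * K * c₃)))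
    (fun l j x => by
      rw [pd_pd_comp_mulVec N hF]
      exact abs_sum_mul_le (fun a => hNK a j)
        (fun a => abs_sum_mul_le (fun b => hNK b l) (fun b => h₂ b a _) hK0) hK0)
    (fun k l j x => by
      rw [pd_pd_pd_comp_mulVec N hF]
      exact abs_sum_mul_le (fun a => hNK a j) (fun a => abs_sum_mul_le (fun b => hNK b l)
        (fun b => abs_sum_mul_le (fun c => hNK c k) (fun c => h₃ c b a _) hK0) hK0) hK0)
    (by positivity) (by positivity)
  have hint (a) : Integrable (ξ a) P := IsAEBounded.integrable ⟨hξ a, B, hbound a⟩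
  simp_rw [standardized_colSum hint hmean,
    steinOp_mulVec (invSqrt_mul_mul_transpose hpos) hF]
  exact h.trans_eq (by ring)

end Main

end NegAssoc

theorem theorem1p4 {Ω : Type*} [MeasurableSpace Ω] (P : Measure Ω) [IsProbabilityMeasure P]
    (m p : ℕ) (hm : 1 ≤ m) (hp : 1 ≤ p)
    (ξ : Fin m × Fin p → Ω → ℝ) (hξ : ∀ a, AEMeasurable (ξ a) P)
    (hNA : NegAssoc.NegativelyAssociated P ξ)
    (hmean : ∀ a, ∫ ω, ξ a ω ∂P = 0)
    (B : ℝ) (hB : 0 < B) (hbound : ∀ a, ∀ᵐ ω ∂P, |ξ a ω| ≤ B)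
    (V : Matrix (Fin p) (Fin p) ℝ) (hV : V = NegAssoc.covMatrix P (NegAssoc.colSum ξ))
    (hpos : V.PosDef) :
    NegAssoc.smoothDist 3 (P.map (NegAssoc.standardized P (NegAssoc.colSum ξ)))
        (NegAssoc.stdNormal p) ≤
      5 / 6 * (p : ℝ) ^ 3 * B * NegAssoc.entrySup (NegAssoc.invSqrt V) ^ 3 * ∑ j, V j j
      - (3 / 2 * (p : ℝ) ^ 3 * B * NegAssoc.entrySup (NegAssoc.invSqrt V) ^ 3
          + (p : ℝ) ^ 2 * NegAssoc.entrySup (NegAssoc.invSqrt V) ^ 2)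
        * ∑ j, ∑ i, ∑ k with i ≠ k, cov[ξ (i, j), ξ (k, j); P]
      - (2 / 3 * (p : ℝ) ^ 3 * B * NegAssoc.entrySup (NegAssoc.invSqrt V) ^ 3
          + (p : ℝ) ^ 2 * NegAssoc.entrySup (NegAssoc.invSqrt V) ^ 2)
        * ∑ j, ∑ l with j ≠ l, V j l := by
  have bξ (a) : NegAssoc.IsAEBounded P (ξ a) := ⟨hξ a, B, hbound a⟩
  set W := NegAssoc.standardized P (NegAssoc.colSum ξ) with hW
  set K := NegAssoc.entrySup (NegAssoc.invSqrt V) with hK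
  set D := ∑ j, ∑ i, ∑ k with i ≠ k, cov[ξ (i, j), ξ (k, j); P] with hD
  set O := ∑ j, ∑ l with j ≠ l, V j l with hO
  set T := ∑ j, V j j with hT
  have hK0 : 0 ≤ K := NegAssoc.entrySup_nonneg _
  have hD0 : D ≤ 0 := Finset.sum_nonpos fun j _ => Finset.sum_nonpos fun i _ =>
    Finset.sum_nonpos fun k hk => hNA.cov_nonpos bξ (by simpa using (Finset.mem_filter.1 hk).2)
  have hT0 : 0 ≤ T := Finset.sum_nonneg fun j _ => hpos.diag_pos.le
  have bW (j : Fin p) : NegAssoc.IsAEBounded P fun ω => W ω j := by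
    simp_rw [hW, NegAssoc.standardized_colSum (fun a => (bξ a).integrable) hmean]
    exact NegAssoc.IsAEBounded.comp_continuous (X := fun ω l => NegAssoc.colSum ξ l ω)
      (g := fun v => (NegAssoc.invSqrt (NegAssoc.covMatrix P (NegAssoc.colSum ξ))).mulVec v j)
      (fun l => NegAssoc.isAEBounded_colSum bξ l)
      ((continuous_apply j).comp (Continuous.matrix_mulVec continuous_const continuous_id))
  have mW : AEMeasurable W P := aemeasurable_pi_lambda _ fun j => (bW j).1
  have : IsProbabilityMeasure (P.map W) := Measure.isProbabilityMeasure_map mW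
  have hν (i : Fin p) : Integrable (fun w : Fin p → ℝ => w i) (P.map W) :=
    (integrable_map_measure (measurable_pi_apply i).aestronglyMeasurable mW).2 (bW i).integrable
  have smooth {f : (Fin p → ℝ) → ℝ} (hf : NegAssoc.IsSmoothUnit f) :
      |∫ w, f w ∂(P.map W) - ∫ z, f z ∂NegAssoc.stdNormal p|
        ≤ -(2 * (p : ℝ) ^ 2 * K ^ 2 * (D + O)) / 2
          + (p : ℝ) ^ 3 * B * K ^ 3 * (2 * T - 4 * D - 2 * O) / 3 := by
    refine NegAssoc.abs_integral_sub_stdNormal_le hν (fun F c₂ c₃ hF h₂ h₃ hc₂ hc₃ => ?_) hf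
    have hFc : Continuous (NegAssoc.steinOp F) := by
      have d1 (i : Fin p) := (NegAssoc.contDiff_pd hF i).continuous
      have d2 (i : Fin p) := (NegAssoc.contDiff_pd (NegAssoc.contDiff_pd hF i) i).continuous
      unfold NegAssoc.steinOp
      fun_prop
    rw [integral_map mW hFc.aestronglyMeasurable]
    subst hV
    exact hNA.abs_integral_steinOp_le hξ hmean hB.le hbound hpos hF h₂ h₃ hc₂ hc₃ hK
  have compare : -(2 * (p : ℝ) ^ 2 * K ^ 2 * (D + O)) / 2
      + (p : ℝ) ^ 3 * B * K ^ 3 * (2 * T - 4 * D - 2 * O) / 3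
      ≤ 5 / 6 * (p : ℝ) ^ 3 * B * K ^ 3 * T - (3 / 2 * (p : ℝ) ^ 3 * B * K ^ 3
        + (p : ℝ) ^ 2 * K ^ 2) * D - (2 / 3 * (p : ℝ) ^ 3 * B * K ^ 3 + (p : ℝ) ^ 2 * K ^ 2) * O := by
    have hc : 0 ≤ (p : ℝ) ^ 3 * B * K ^ 3 := by positivity
    nlinarith [mul_nonneg hc hT0, mul_nonneg hc (neg_nonneg.2 hD0)]
  refine Real.iSup_le (fun h => ?_) ?_
  · have hh := NegAssoc.hasBoundedIncrements_of_mem_smoothBall h.2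
    have hi (μ : Measure (Fin p → ℝ)) [IsProbabilityMeasure μ] : Integrable h.1 μ :=
      Integrable.of_bound hh.continuous.aestronglyMeasurable 1
        (Filter.Eventually.of_forall hh.zero)
    refine le_of_forall_pos_le_add fun ε hε => ?_
    obtain ⟨f, hf, hfh⟩ := hh.exists_isSmoothUnit (half_pos hε)
    have close (μ : Measure (Fin p → ℝ)) [IsProbabilityMeasure μ] :
        |∫ x, f x ∂μ - ∫ x, h.1 x ∂μ| ≤ ε / 2 := by
      have hfi : Integrable f μ := Integrable.of_bound
        hf.contDiff.continuous.aestronglyMeasurable 1 (Filter.Eventually.of_forall hf.zero)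
      rw [← integral_sub hfi (hi μ)]
      have := norm_integral_le_of_norm_le_const (μ := μ) (f := fun x => f x - h.1 x)
        (C := ε / 2) (Filter.Eventually.of_forall hfh)
      simpa using this
    have e1 := abs_le.1 (close (P.map W))
    have e2 := abs_le.1 (close (NegAssoc.stdNormal p))
    have e3 := abs_le.1 (smooth hf)
    rw [abs_le]
    constructor <;> linarith [e1.1, e1.2, e2.1, e2.2, e3.1, e3.2]
  · -- the bound is nonnegative because it applies to the test function `0`
    have h0 : NegAssoc.IsSmoothUnit (fun _ : Fin p → ℝ => (0 : ℝ)) := by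
      have e (i : Fin p) : NegAssoc.pd i (fun _ : Fin p → ℝ => (0 : ℝ)) = fun _ => 0 := by
        funext x; simp [NegAssoc.pd]
      exact ⟨contDiff_const, by simp, by simp [e], by simp [e], by simp [e]⟩
    exact (abs_nonneg _).trans ((smooth h0).trans compare)
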